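/- Let $\Gamma$ be a finitely generated group and let $\lambda$ be its left regular representation on $\ell^2(\Gamma)$. For $q=\sum_g q_g g\in\mathbb C[\Gamma]$ put $\lambda(q)=\sum_g q_g\lambda(g)$ and $\|q\|_2=(\sum_g|q_g|^2)^{1/2}$. For a finite generating set $S$ of $\Gamma$ let $|g|_S$ be the word length, and let $\mathrm{diam}_S(q)$ be the maximum of $1$ and of all $|hg^{-1}|_S$ with $g,h$ in the support of $q$. Assume the following. (RD) $\Gamma$ has the rapid decay property with an exponent $C_1>0$: for some finite generating set $S'$ and some $C>0$, $\|\lambda(q)\|_{\rm op}\le C\,\mathrm{diam}_{S'}(q)^{C_1}\|q\|_2$ for all $q\in\mathbb C[\Gamma]$. (Convergence in distribution) $\rho_N:\Gamma\to S_N$, along a sequence of integers $N\to\infty$, are permutation representations with $\frac1N\mathrm{Tr}\,\rho_N(g)\to0$ for every $g\ne e$. Write $g.x=\rho_N(g)(x)$ for the action on $[N]=\{1,\dots,N\}$, identify $\rho_N(g)$ with its permutation matrix $\rho_N(g)(x,y)=\mathbf 1(x=g.y)$, and put $\rho_N(q)=\sum_g q_g\rho_N(g)$ for $q\in\mathbb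 C[\Gamma]$. (AC) $p\in\mathbb C[\Gamma]$ satisfies $p=p^*$, that is $p_{g^{-1}}=\overline{p_g}$, and $I_0\subset\mathbb R$ is a compact interval such that, with $R^z=(\lambda(p)-z\,\mathrm{Id})^{-1}$, $\Im R^z=(R^z-(R^z)^*)/(2i)$ and $Q(x,y)=\langle\delta_x,Q\delta_y\rangle$, for some $C_0\ge1$, $$C_0^{-1}\le \Im R^{E+i\eta}(e,e)\le C_0\qquad\text{for all }E\in I_0,\ 0<\eta\le1 .$$ (Fourth moment) For some $C_1'>2C_1+1$ and a fixed finite generating set $S$ of $\Gamma$, $$\lim_{\eta\downarrow0}\ \sup_{E\in I_0}\ \sum_{g\in\Gamma}\eta^2\,|(\Im R^{E+i\eta})(e,g)|^4\,|g|_S^{C_1'}=0 .$$ Let $I=[a,b]$, $a<b$, be contained in the interior of $I_0$, and let $T\subset\Gamma$ be finite. Then there are subspaces $H_N\subset\mathbb C^N$ with $\dim H_N=o(N)$ such that the following holds for every choice, for each $N$, of an orthonormal basis $(\varphi_\alpha)_{\alpha\in[N]}$ of eigenvectors of $\rho_N(p)$ with eigenvalues $(\lambda_\alpha)$, and for every sequence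 of matrices $K_N\in M_N(\mathbb C)$ such that - $K_N(x,y)=0$ unless $x=g.y$ for some $g\in T$ ($T$-locality), - $|K_N(x,y)|\le1$ for all $x,y\in[N]$, - $(K_N(t.x,x))_{x\in[N]}\in H_N^\perp$ for all $t\in T$. Let $\Lambda_J=\{\alpha:\lambda_\alpha\in J\}$ and $J_E^\eta=[E-\eta,E+\eta]$, and let $$\langle K_N\rangle=\sum_{g\in T}k_{N,g}\,\rho_N(g),\qquad k_{N,g}=\frac1N\sum_{x=1}^N K_N(g.x,x).$$ Then quantum ergodicity holds in $I$: $$\lim_{N\to\infty}\frac1{|\Lambda_I|}\sum_{\alpha\in\Lambda_I}\bigl|\langle\varphi_\alpha,K_N\varphi_\alpha\rangle-\langle\varphi_\alpha,\langle K_N\rangle\varphi_\alpha\rangle\bigr|^2=0,$$ and quantum mixing holds in $I$: for all $E_1,E_2$ in the interior of $I$, $$\lim_{\eta\downarrow0}\ \limsup_{N\to\infty}\ \frac1{|\Lambda_{J_{E_1}^\eta}|}\sum_{\alpha\in\Lambda_{J_{E_1}^\eta}}\ \sum_{\beta\in\Lambda_{J_{E_2}^\eta}}\bigl|\langle\varphi_\beta,K_N\varphi_\alpha\rangle-\langle\varphi_\beta,\langle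 K_N\rangle\varphi_\alpha\rangle\bigr|^2=0 .$$ (Here an average over an empty index set is $0$.) -/

import Mathlib

open Filter Topology
open scoped ENNReal ComplexConjugate

noncomputable section

namespace QMix

/-! ### Word length and the rapid decay property -/

section Cayley

variable {Γ : Type*} [Group Γ]

/-- `|g|`: the length of `g` in the word metric of the set `S` (letters from `S ∪ S⁻¹`). -/
def wordLength (S : Finset Γ) (g : Γ) : ℕ :=
  sInf {n : ℕ | ∃ l : List Γ, l.length = n ∧ (∀ s ∈ l, s ∈ S ∨ s⁻¹ ∈ S) ∧ l.prod = g}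

/-- `diam_S(p)`: the maximum of one and the diameter of the support of `p` in the left Cayley
graph, whose edges join `g` to `s * g`, so that the distance from `g` to `h` is `|h * g⁻¹|`. -/
def diamSupp (S : Finset Γ) (p : MonoidAlgebra ℂ Γ) : ℕ :=
  max 1 (p.coeff.support.sup fun g => p.coeff.support.sup fun h => wordLength S (h * g⁻¹))

/-- `‖p‖₂ = (∑_g |p_g|²)^{1/2}`. -/
def l2norm (p : MonoidAlgebra ℂ Γ) : ℝ :=
  Real.sqrt (∑ g ∈ p.coeff.support, ‖p.coeff g‖ ^ 2)

/-- The Hilbert space `ℓ²(Γ)`. -/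
abbrev Ell2 (Γ : Type*) : Type _ := lp (fun _ : Γ => ℂ) 2

theorem memℓp_translate (g : Γ) (f : Ell2 Γ) :
    Memℓp (fun x : Γ => (f : Γ → ℂ) (g⁻¹ * x)) 2 := by
  have h := lp.memℓp f
  rw [memℓp_gen_iff (by norm_num)] at h ⊢
  exact h.comp_injective (mul_right_injective g⁻¹)

/-- The left regular representation `λ(g)`: `(λ(g) f)(x) = f(g⁻¹ x)`, i.e. `λ(g) δ_v = δ_{gv}`. -/
def leftReg (g : Γ) : Ell2 Γ →L[ℂ] Ell2 Γ :=
  LinearIsometry.toContinuousLinearMap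
    { toFun := fun f => ⟨fun x => (f : Γ → ℂ) (g⁻¹ * x), memℓp_translate g f⟩
      map_add' := fun _ _ => rfl
      map_smul' := fun _ _ => rfl
      norm_map' := fun f => by
        rw [lp.norm_eq_tsum_rpow (by norm_num), lp.norm_eq_tsum_rpow (by norm_num)]
        congr 1
        exact (Equiv.mulLeft g⁻¹).tsum_eq
          (fun x => ‖(f : Γ → ℂ) x‖ ^ (2 : ℝ≥0∞).toReal) }

/-- `λ(p) = ∑_g p_g λ(g)`. -/
def leftRegAlg (p : MonoidAlgebra ℂ Γ) : Ell2 Γ →L[ℂ] Ell2 Γ :=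
  ∑ g ∈ p.coeff.support, p.coeff g • leftReg g

/-- `Γ` has the rapid decay property with exponent `C₁`: for some finite generating set `S` and
some `C > 0`, `‖λ(p)‖ ≤ C diam_S(p)^{C₁} ‖p‖₂` for all `p ∈ ℂ[Γ]`. -/
def HasRapidDecayWith (Γ : Type*) [Group Γ] (C₁ : ℝ) : Prop :=
  0 < C₁ ∧ ∃ S : Finset Γ, Subgroup.closure (S : Set Γ) = ⊤ ∧ ∃ C : ℝ, 0 < C ∧
    ∀ p : MonoidAlgebra ℂ Γ, ‖leftRegAlg p‖ ≤ C * (diamSupp S p : ℝ) ^ C₁ * l2norm p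

/-! ### Resolvents -/

open Classical in
/-- The matrix entry `Q(x,y) = ⟨δ_x, Q δ_y⟩`. -/
def entry (Q : Ell2 Γ →L[ℂ] Ell2 Γ) (x y : Γ) : ℂ :=
  inner ℂ (lp.single 2 x (1 : ℂ) : Ell2 Γ) (Q (lp.single 2 y (1 : ℂ)))

/-- The resolvent `R^z = (P - z Id)⁻¹` (a genuine inverse for self-adjoint `P`, `Im z ≠ 0`). -/
def resolv (P : Ell2 Γ →L[ℂ] Ell2 Γ) (z : ℂ) : Ell2 Γ →L[ℂ] Ell2 Γ :=
  Ring.inverse (P - z • ContinuousLinearMap.id ℂ (Ell2 Γ))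

/-- `Im R = (R - R*) / (2i)`. -/
def imOp (R : Ell2 Γ →L[ℂ] Ell2 Γ) : Ell2 Γ →L[ℂ] Ell2 Γ :=
  (2 * Complex.I)⁻¹ • (R - ContinuousLinearMap.adjoint R)

/-- `(Im R^{E + iη})(x,y)` for the operator `P = λ(p)`. -/
def imRes (p : MonoidAlgebra ℂ Γ) (E η : ℝ) (x y : Γ) : ℂ :=
  entry (imOp (resolv (leftRegAlg p) ((E : ℂ) + (η : ℂ) * Complex.I))) x y

/-- Condition (AC) on `I₀`: for some `C₀ ≥ 1`, `C₀⁻¹ ≤ Im R^{E+iη}(e,e) ≤ C₀` for all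
`E ∈ I₀` and `0 < η ≤ 1` (the entry is a real number). -/
def CondAC (p : MonoidAlgebra ℂ Γ) (I₀ : Set ℝ) : Prop :=
  ∃ C₀ : ℝ, 1 ≤ C₀ ∧ ∀ E ∈ I₀, ∀ η : ℝ, 0 < η → η ≤ 1 →
    C₀⁻¹ ≤ (imRes p E η 1 1).re ∧ (imRes p E η 1 1).re ≤ C₀

/-- The fourth-moment resolvent condition on `I₀` with weight `|g|^a`:
`sup_{E ∈ I₀} ∑_g η² |(Im R^{E+iη})(e,g)|⁴ |g|^a → 0` as `η ↓ 0`. -/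
def FourthMoment (S : Finset Γ) (p : MonoidAlgebra ℂ Γ) (I₀ : Set ℝ) (a : ℝ) : Prop :=
  Tendsto (fun η : ℝ => ⨆ E ∈ I₀, ∑' g : Γ,
      ENNReal.ofReal (η ^ 2 * ‖imRes p E η 1 g‖ ^ 4 * (wordLength S g : ℝ) ^ a))
    (𝓝[>] 0) (𝓝 0)

/-! ### Finite permutation representations -/

/-- The permutation matrix `ρ(g)(x,y) = 1(x = g.y)`. -/
def permMat {N : ℕ} (ρ : Γ →* Equiv.Perm (Fin N)) (g : Γ) : Matrix (Fin N) (Fin N) ℂ :=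
  Matrix.of fun x y => if x = ρ g y then 1 else 0

/-- `ρ(p) = ∑_g p_g ρ(g)`. -/
def permAlg {N : ℕ} (ρ : Γ →* Equiv.Perm (Fin N)) (p : MonoidAlgebra ℂ Γ) :
    Matrix (Fin N) (Fin N) ℂ :=
  ∑ g ∈ p.coeff.support, p.coeff g • permMat ρ g

/-- Convergence in distribution of `ρ_n : Γ → S_{N n}` to the regular representation:
`(1/N) Tr ρ_N(g) → 0` for every `g ≠ e`. -/
def ConvDistr {N : ℕ → ℕ} (ρ : ∀ n, Γ →* Equiv.Perm (Fin (N n))) : Prop :=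
  ∀ g : Γ, g ≠ 1 → Tendsto (fun n => (permMat (ρ n) g).trace / (N n : ℂ)) atTop (𝓝 0)

/-- `K` is `T`-local: `K(x,y) = 0` unless `x = g.y` for some `g ∈ T`. -/
def IsLocal {N : ℕ} (ρ : Γ →* Equiv.Perm (Fin N)) (T : Finset Γ)
    (K : Matrix (Fin N) (Fin N) ℂ) : Prop :=
  ∀ x y, (¬ ∃ g ∈ T, x = ρ g y) → K x y = 0

/-- The vector `(K(g.x, x))_x ∈ ℂ^N`. -/
def diagVec {N : ℕ} (ρ : Γ →* Equiv.Perm (Fin N)) (K : Matrix (Fin N) (Fin N) ℂ) (g : Γ) :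
    EuclideanSpace ℂ (Fin N) :=
  WithLp.toLp 2 fun x => K (ρ g x) x

/-- The average `⟨K⟩ = ∑_{g ∈ T} k_g ρ(g)` of a `T`-local matrix, `k_g = (1/N) ∑_x K(g.x, x)`. -/
def average {N : ℕ} (ρ : Γ →* Equiv.Perm (Fin N)) (T : Finset Γ)
    (K : Matrix (Fin N) (Fin N) ℂ) : Matrix (Fin N) (Fin N) ℂ :=
  ∑ g ∈ T, ((∑ x, K (ρ g x) x) / (N : ℂ)) • permMat ρ g

end Cayley

/-! ### Quantum ergodicity and quantum mixing -/

/-- `(φ_α)` is an orthonormal basis of eigenvectors of `A` with (real) eigenvalues `(ev_α)`. -/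
def IsEigenbasis {N : ℕ} (A : Matrix (Fin N) (Fin N) ℂ)
    (φ : OrthonormalBasis (Fin N) ℂ (EuclideanSpace ℂ (Fin N))) (ev : Fin N → ℝ) : Prop :=
  ∀ α, Matrix.toEuclideanLin A (φ α) = (ev α : ℂ) • φ α

open Classical in
/-- `Λ_J`: the set of indices `α` with `ev_α ∈ J`. -/
def specSet {N : ℕ} (ev : Fin N → ℝ) (J : Set ℝ) : Finset (Fin N) :=
  Finset.univ.filter fun α => ev α ∈ J

/-- `|⟨φ_β, K φ_α⟩ - ⟨φ_β, K' φ_α⟩|²`. -/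
def coefSq {N : ℕ} (φ : OrthonormalBasis (Fin N) ℂ (EuclideanSpace ℂ (Fin N)))
    (K K' : Matrix (Fin N) (Fin N) ℂ) (β α : Fin N) : ℝ :=
  ‖inner ℂ (φ β) (Matrix.toEuclideanLin K (φ α))
    - inner ℂ (φ β) (Matrix.toEuclideanLin K' (φ α))‖ ^ 2

/-- Quantum ergodicity in `I` for observables `K_n` with averages `Kav_n`
(the quantity is `0` when `Λ_I` is empty). -/
def QuantumErgodic {N : ℕ → ℕ}
    (φ : ∀ n, OrthonormalBasis (Fin (N n)) ℂ (EuclideanSpace ℂ (Fin (N n))))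
    (ev : ∀ n, Fin (N n) → ℝ) (K Kav : ∀ n, Matrix (Fin (N n)) (Fin (N n)) ℂ)
    (I : Set ℝ) : Prop :=
  Tendsto (fun n => (((specSet (ev n) I).card : ℝ))⁻¹ *
    ∑ α ∈ specSet (ev n) I, coefSq (φ n) (K n) (Kav n) α α) atTop (𝓝 0)

/-- Small-scale quantum weak mixing in `I`: for all `E₁, E₂` in the interior of `I`, with
`J_E^η = [E - η, E + η]`, the limit as `η ↓ 0` of the `limsup` as `n → ∞` (taken in `[0,∞]`) of
`|Λ_{J_{E₁}^η}|⁻¹ ∑_{α ∈ Λ_{J_{E₁}^η}} ∑_{β ∈ Λ_{J_{E₂}^η}} |⟨φ_β, (K - ⟨K⟩) φ_α⟩|²` is `0`. -/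
def QuantumMixing {N : ℕ → ℕ}
    (φ : ∀ n, OrthonormalBasis (Fin (N n)) ℂ (EuclideanSpace ℂ (Fin (N n))))
    (ev : ∀ n, Fin (N n) → ℝ) (K Kav : ∀ n, Matrix (Fin (N n)) (Fin (N n)) ℂ)
    (I : Set ℝ) : Prop :=
  ∀ E₁ ∈ interior I, ∀ E₂ ∈ interior I,
    Tendsto (fun η : ℝ => limsup (fun n => ENNReal.ofReal
        ((((specSet (ev n) (Set.Icc (E₁ - η) (E₁ + η))).card : ℝ))⁻¹ *
          ∑ α ∈ specSet (ev n) (Set.Icc (E₁ - η) (E₁ + η)),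
            ∑ β ∈ specSet (ev n) (Set.Icc (E₂ - η) (E₂ + η)),
              coefSq (φ n) (K n) (Kav n) β α)) atTop)
      (𝓝[>] 0) (𝓝 0)

end QMix

end

set_option linter.unusedSectionVars false

noncomputable section

namespace QMix

/-! ### The two representations of the group algebra, and convergence of traces -/

section GroupAlgebra

variable {Γ : Type*} [Group Γ]

/-! Write `E₁`, `E₂` for two energies and `η` for a scale. A multiple of the Poisson kernel of width
`η` majorizes the indicator of a window of size `η`, so the sum of `|⟨φ_β, K φ_α⟩|²` over a pair of
windows is at most a constant times `η² Tr (K* A₂ K A₁)`, where `A_i` is the Poisson kernel of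
`ρ_N(p)` at `E_i`. A truncated Neumann series makes the kernel a polynomial, nonnegative on the
spectrum and exponentially accurate in its degree. Then `A_i = ρ_N(q_i)`, where `q_i` in the group
algebra does not depend on `N` and `λ(q_i)` is close to `Im R^{E_i + iη}`
(`norm_leftRegLift_poissonElt_sub_le`).

Up to the few points where two elements of `T` act alike, the centred observable is `∑_t ρ(t)
D(b_t)`, up to a factor 2. The trace expands into sums over the fixed points of words `hg`.
Convergence in distribution leaves only `hg = e`, with an error `o(N)`, and these terms add up to
`∑_{t,t'} ⟨b_t, ρ(w) b_{t'}⟩`, where `w = pairElt q₁ q₂ t t'` has coefficients `q₂(t h t'⁻¹)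
q₁(h⁻¹)` (`norm_trace_sub_inner_le`).

Rapid decay bounds `‖λ(w)‖` by a weighted `ℓ²` norm of `w`. Since the coefficients of `w` are
products, this norm is controlled by weighted `ℓ⁴` sums of `q₁` and `q₂`, hence by the fourth
moments of the resolvent. The result is `η ‖λ(w)‖ → 0` (`eventually_norm_pairElt_le`).

Strong convergence of `ρ_N` is not available, but convergence of moments shows that all but `o(N)`
singular values of `ρ_N(w)` are below any number larger than `‖λ(w)‖` (`exists_submodule_permLift`).
The exceptional singular vectors go into `H_N`. Only dyadic scales and grid energies are needed, so
a diagonal argument over a countable family gives one sequence `H_N`. Orthogonality to it makes each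
block sum `o(η) N` (`exists_submodule_block`).

Condition (AC) gives at least `c η N` eigenvalues in a window (`exists_le_card_specSet`), and
division gives mixing. For ergodicity, `I` is covered by `O(1/η)` windows and the diagonal terms are
bounded by the block sums. -/

theorem leftReg_apply (g : Γ) (f : Ell2 Γ) (x : Γ) :
    (leftReg g f : Γ → ℂ) x = (f : Γ → ℂ) (g⁻¹ * x) := rfl

/-- The left regular representation as a monoid homomorphism. -/
def leftRegHom (Γ : Type*) [Group Γ] : Γ →* (Ell2 Γ →L[ℂ] Ell2 Γ) where
  toFun := leftReg
  map_one' := by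
    ext f x
    simp [leftReg_apply]
  map_mul' g h := by
    ext f x
    simp [leftReg_apply, mul_assoc]

/-- The left regular representation of the group algebra. -/
def leftRegLift (Γ : Type*) [Group Γ] : MonoidAlgebra ℂ Γ →ₐ[ℂ] (Ell2 Γ →L[ℂ] Ell2 Γ) :=
  MonoidAlgebra.lift ℂ _ Γ (leftRegHom Γ)

theorem leftRegLift_apply (q : MonoidAlgebra ℂ Γ) : leftRegLift Γ q = leftRegAlg q := by
  rw [leftRegLift, MonoidAlgebra.lift_apply]; rfl

/-- A permutation representation as a monoid homomorphism into matrices. -/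
def permHom {N : ℕ} (ρ : Γ →* Equiv.Perm (Fin N)) : Γ →* Matrix (Fin N) (Fin N) ℂ where
  toFun := permMat ρ
  map_one' := by
    ext x y
    simp [permMat, Matrix.one_apply]
  map_mul' g h := by
    ext x y
    simp [permMat, Matrix.mul_apply]

/-- A permutation representation extended to the group algebra. -/
def permLift {N : ℕ} (ρ : Γ →* Equiv.Perm (Fin N)) :
    MonoidAlgebra ℂ Γ →ₐ[ℂ] Matrix (Fin N) (Fin N) ℂ :=
  MonoidAlgebra.lift ℂ _ Γ (permHom ρ)

theorem permLift_apply {N : ℕ} (ρ : Γ →* Equiv.Perm (Fin N)) (q : MonoidAlgebra ℂ Γ) :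
    permLift ρ q = permAlg ρ q := by
  rw [permLift, MonoidAlgebra.lift_apply]; rfl

theorem permLift_single {N : ℕ} (ρ : Γ →* Equiv.Perm (Fin N)) (g : Γ) (c : ℂ) :
    permLift ρ (MonoidAlgebra.single g c) = c • permMat ρ g := by
  rw [permLift, MonoidAlgebra.lift_single]; rfl

theorem leftRegLift_single (g : Γ) (c : ℂ) :
    leftRegLift Γ (MonoidAlgebra.single g c) = c • leftReg g := by
  rw [leftRegLift, MonoidAlgebra.lift_single]; rfl

/-- The adjoint `q*`, with `q*_g` the conjugate of `q_{g⁻¹}`. -/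
def adj (q : MonoidAlgebra ℂ Γ) : MonoidAlgebra ℂ Γ :=
  MonoidAlgebra.ofCoeff
    ((q.coeff.mapRange (starRingEnd ℂ) (map_zero _)).equivMapDomain (Equiv.inv Γ))

theorem adj_coeff (q : MonoidAlgebra ℂ Γ) (g : Γ) :
    (adj q).coeff g = (starRingEnd ℂ) (q.coeff g⁻¹) := by
  simp [adj, Finsupp.equivMapDomain_apply]

theorem adj_zero : adj (0 : MonoidAlgebra ℂ Γ) = 0 := by
  ext g; simp [adj_coeff]

theorem adj_add (q r : MonoidAlgebra ℂ Γ) : adj (q + r) = adj q + adj r := by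
  ext g; simp [adj_coeff]

theorem adj_single (g : Γ) (c : ℂ) :
    adj (MonoidAlgebra.single g c) = MonoidAlgebra.single g⁻¹ ((starRingEnd ℂ) c) := by
  ext h
  classical
  rw [adj_coeff, MonoidAlgebra.coeff_single, MonoidAlgebra.coeff_single, Finsupp.single_apply,
    Finsupp.single_apply]
  simp only [inv_eq_iff_eq_inv (a := g)]
  split_ifs <;> simp

theorem adjoint_leftReg (g : Γ) :
    ContinuousLinearMap.adjoint (leftReg g) = leftReg g⁻¹ := by
  symm
  rw [ContinuousLinearMap.eq_adjoint_iff]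
  intro f f'
  rw [lp.inner_eq_tsum, lp.inner_eq_tsum]
  simp only [RCLike.inner_apply, leftReg_apply, inv_inv]
  rw [← (Equiv.mulLeft g).tsum_eq
    (fun i => (f' : Γ → ℂ) (g⁻¹ * i) * (starRingEnd ℂ) ((f : Γ → ℂ) i))]
  simp

theorem adjoint_leftRegLift (q : MonoidAlgebra ℂ Γ) :
    star (leftRegLift Γ q) = leftRegLift Γ (adj q) := by
  induction q using MonoidAlgebra.induction_linear with
  | zero => simp [adj_zero]
  | add f g hf hg => rw [map_add, star_add, hf, hg, adj_add, map_add]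
  | single g c =>
    rw [adj_single, leftRegLift_single, leftRegLift_single, star_smul,
      ContinuousLinearMap.star_eq_adjoint, adjoint_leftReg]
    rfl

theorem conjTranspose_permMat {N : ℕ} (ρ : Γ →* Equiv.Perm (Fin N)) (g : Γ) :
    (permMat ρ g).conjTranspose = permMat ρ g⁻¹ := by
  ext x y
  simp only [permMat, Matrix.conjTranspose_apply, Matrix.of_apply, map_inv,
    Equiv.Perm.eq_inv_iff_eq]
  by_cases h : y = ρ g x
  · simp [h]
  · simp [h, Ne.symm h]

theorem conjTranspose_permLift {N : ℕ} (ρ : Γ →* Equiv.Perm (Fin N)) (q : MonoidAlgebra ℂ Γ) :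
    (permLift ρ q).conjTranspose = permLift ρ (adj q) := by
  induction q using MonoidAlgebra.induction_linear with
  | zero => simp [adj_zero]
  | add f g hf hg => rw [map_add, Matrix.conjTranspose_add, hf, hg, adj_add, map_add]
  | single g c =>
    rw [adj_single, permLift_single, permLift_single, Matrix.conjTranspose_smul,
      conjTranspose_permMat]
    rfl

open Classical in
/-- The basis vector `δ_g` of `ℓ²(Γ)`. -/
def delta (g : Γ) : Ell2 Γ := lp.single 2 g (1 : ℂ)

open Classical in
theorem delta_apply (g x : Γ) : (delta g : Γ → ℂ) x = if x = g then 1 else 0 := by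
  rw [delta, lp.single_apply]
  by_cases h : x = g
  · subst h; simp
  · simp [h]

theorem norm_delta (g : Γ) : ‖delta g‖ = 1 := by
  classical
  rw [delta, lp.norm_single (by norm_num)]; simp

theorem entry_eq (Q : Ell2 Γ →L[ℂ] Ell2 Γ) (x y : Γ) :
    entry Q x y = (Q (delta y) : Γ → ℂ) x := by
  classical
  rw [entry, lp.inner_single_left]
  simp [delta]

theorem leftRegLift_delta_one (q : MonoidAlgebra ℂ Γ) (g : Γ) :
    (leftRegLift Γ q (delta 1) : Γ → ℂ) g = q.coeff g := by
  classical
  induction q using MonoidAlgebra.induction_linear with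
  | zero => simp
  | add f g hf hg => simp [hf, hg]
  | single h c =>
    rw [leftRegLift_single, MonoidAlgebra.coeff_single, Finsupp.single_apply]
    simp [leftReg_apply, delta_apply, inv_mul_eq_one]

theorem sum_sq_le_norm_sq (f : Ell2 Γ) (F : Finset Γ) :
    ∑ g ∈ F, ‖(f : Γ → ℂ) g‖ ^ 2 ≤ ‖f‖ ^ 2 := by
  have := lp.sum_rpow_le_norm_rpow (p := 2) (by norm_num) f F
  simpa using this

theorem sum_sq_apply_delta_le (Q : Ell2 Γ →L[ℂ] Ell2 Γ) (F : Finset Γ) :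
    ∑ g ∈ F, ‖(Q (delta 1) : Γ → ℂ) g‖ ^ 2 ≤ ‖Q‖ ^ 2 := by
  refine (sum_sq_le_norm_sq _ F).trans ?_
  gcongr
  simpa [norm_delta] using Q.le_opNorm (delta 1)

theorem norm_apply_delta_le (Q : Ell2 Γ →L[ℂ] Ell2 Γ) (g : Γ) :
    ‖(Q (delta 1) : Γ → ℂ) g‖ ≤ ‖Q‖ := by
  have := sum_sq_apply_delta_le Q {g}
  rw [Finset.sum_singleton] at this
  exact le_of_sq_le_sq this (norm_nonneg _)

theorem norm_coeff_le (q : MonoidAlgebra ℂ Γ) (g : Γ) : ‖q.coeff g‖ ≤ ‖leftRegLift Γ q‖ := by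
  rw [← leftRegLift_delta_one]; exact norm_apply_delta_le _ _

/-- `‖q‖₁ = ∑_g |q_g|`. -/
def l1norm (q : MonoidAlgebra ℂ Γ) : ℝ := ∑ g ∈ q.coeff.support, ‖q.coeff g‖

theorem l1norm_nonneg (q : MonoidAlgebra ℂ Γ) : 0 ≤ l1norm q :=
  Finset.sum_nonneg fun _ _ => norm_nonneg _

theorem norm_leftReg_le (g : Γ) : ‖leftReg g‖ ≤ 1 :=
  LinearIsometry.norm_toContinuousLinearMap_le _

theorem norm_leftRegLift_le (q : MonoidAlgebra ℂ Γ) : ‖leftRegLift Γ q‖ ≤ l1norm q := by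
  rw [leftRegLift_apply, leftRegAlg]
  refine (norm_sum_le _ _).trans (Finset.sum_le_sum fun g _ => ?_)
  rw [norm_smul]
  exact mul_le_of_le_one_right (norm_nonneg _) (norm_leftReg_le g)

theorem toEuclideanLin_permMat_apply {N : ℕ} (ρ : Γ →* Equiv.Perm (Fin N)) (g : Γ)
    (v : EuclideanSpace ℂ (Fin N)) (x : Fin N) :
    Matrix.toEuclideanLin (permMat ρ g) v x = v (ρ g⁻¹ x) := by
  simp only [Matrix.toLpLin_apply, Matrix.mulVec, dotProduct, permMat, Matrix.of_apply,
    map_inv, ite_mul, one_mul, zero_mul]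
  rw [Finset.sum_eq_single ((ρ g)⁻¹ x)]
  · simp
  · intro b _ hb
    rw [if_neg]
    rintro rfl
    simp at hb
  · simp

theorem norm_permMat_apply {N : ℕ} (ρ : Γ →* Equiv.Perm (Fin N)) (g : Γ)
    (v : EuclideanSpace ℂ (Fin N)) : ‖Matrix.toEuclideanLin (permMat ρ g) v‖ = ‖v‖ := by
  rw [EuclideanSpace.norm_eq, EuclideanSpace.norm_eq]
  congr 1
  simp only [toEuclideanLin_permMat_apply]
  exact Equiv.sum_comp (ρ g⁻¹) (fun x => ‖v x‖ ^ 2)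

theorem norm_permLift_apply_le {N : ℕ} (ρ : Γ →* Equiv.Perm (Fin N)) (q : MonoidAlgebra ℂ Γ)
    (v : EuclideanSpace ℂ (Fin N)) :
    ‖Matrix.toEuclideanLin (permLift ρ q) v‖ ≤ l1norm q * ‖v‖ := by
  rw [permLift_apply, permAlg, map_sum, LinearMap.sum_apply, l1norm, Finset.sum_mul]
  refine (norm_sum_le _ _).trans (Finset.sum_le_sum fun g _ => ?_)
  rw [map_smul, LinearMap.smul_apply, norm_smul, norm_permMat_apply]

theorem trace_permLift {N : ℕ} (ρ : Γ →* Equiv.Perm (Fin N)) (q : MonoidAlgebra ℂ Γ) :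
    (permLift ρ q).trace = ∑ g ∈ q.coeff.support, q.coeff g * (permMat ρ g).trace := by
  rw [permLift_apply, permAlg, Matrix.trace_sum]
  simp [Matrix.trace_smul]

theorem tendsto_trace_permMat {N : ℕ → ℕ} (hN : Tendsto N atTop atTop)
    {ρ : ∀ n, Γ →* Equiv.Perm (Fin (N n))} (hρ : ConvDistr ρ) (g : Γ) [Decidable (g = 1)] :
    Tendsto (fun n => (permMat (ρ n) g).trace / (N n : ℂ)) atTop (𝓝 (if g = 1 then 1 else 0)) := by
  split_ifs with h
  · subst h
    refine tendsto_const_nhds.congr' ?_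
    filter_upwards [hN.eventually_gt_atTop 0] with n hn
    have : permMat (ρ n) 1 = 1 := (permHom (ρ n)).map_one
    rw [this, Matrix.trace_one, Fintype.card_fin, div_self]
    exact_mod_cast hn.ne'
  · exact hρ g h

/-- By linearity from single group elements. The limit is the canonical trace, so the moments of
every `ρ_N(q)` converge to those of `λ(q)`. -/
theorem tendsto_trace_permLift {N : ℕ → ℕ} (hN : Tendsto N atTop atTop)
    {ρ : ∀ n, Γ →* Equiv.Perm (Fin (N n))} (hρ : ConvDistr ρ) (q : MonoidAlgebra ℂ Γ) :
    Tendsto (fun n => (permLift (ρ n) q).trace / (N n : ℂ)) atTop (𝓝 (q.coeff 1)) := by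
  classical
  have h : Tendsto (fun n => ∑ g ∈ q.coeff.support,
      q.coeff g * ((permMat (ρ n) g).trace / (N n : ℂ))) atTop
      (𝓝 (∑ g ∈ q.coeff.support, q.coeff g * (if g = 1 then 1 else 0))) :=
    tendsto_finsetSum _ fun g _ => (tendsto_trace_permMat hN hρ g).const_mul _
  have e : ∑ g ∈ q.coeff.support, q.coeff g * (if g = 1 then 1 else 0) = q.coeff 1 := by
    simp [mul_ite, eq_comm]
  rw [e] at h
  refine h.congr fun n => ?_
  rw [trace_permLift, Finset.sum_div]
  simp only [mul_div_assoc]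

end GroupAlgebra

/-! ### Word length -/

section WordLength

variable {Γ : Type*} [Group Γ]

theorem wordLength_le {S : Finset Γ} {l : List Γ} (hl : ∀ s ∈ l, s ∈ S ∨ s⁻¹ ∈ S) :
    wordLength S l.prod ≤ l.length :=
  Nat.sInf_le ⟨l, rfl, hl, rfl⟩

theorem exists_word {S : Finset Γ} (hS : Subgroup.closure (S : Set Γ) = ⊤) (g : Γ) :
    ∃ l : List Γ, l.length = wordLength S g ∧ (∀ s ∈ l, s ∈ S ∨ s⁻¹ ∈ S) ∧ l.prod = g := by
  have hg : g ∈ Subgroup.closure (S : Set Γ) := by rw [hS]; trivial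
  rw [← Subgroup.mem_toSubmonoid, Subgroup.closure_toSubmonoid] at hg
  obtain ⟨l, hl, hlg⟩ := Submonoid.exists_list_of_mem_closure hg
  exact Nat.sInf_mem (s := {n : ℕ | ∃ l : List Γ, l.length = n ∧
    (∀ s ∈ l, s ∈ S ∨ s⁻¹ ∈ S) ∧ l.prod = g}) ⟨l.length, l, rfl, by simpa using hl, hlg⟩

theorem wordLength_one (S : Finset Γ) : wordLength S 1 = 0 := by
  simpa using wordLength_le (S := S) (l := []) (by simp)

theorem wordLength_mul_le {S : Finset Γ} (hS : Subgroup.closure (S : Set Γ) = ⊤) (g h : Γ) :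
    wordLength S (g * h) ≤ wordLength S g + wordLength S h := by
  obtain ⟨l, h1, h2, rfl⟩ := exists_word hS g
  obtain ⟨l', h1', h2', rfl⟩ := exists_word hS h
  rw [← h1, ← h1', ← List.length_append, ← List.prod_append]
  refine wordLength_le fun s hs => ?_
  rcases List.mem_append.1 hs with hs | hs
  exacts [h2 s hs, h2' s hs]

theorem wordLength_inv_le {S : Finset Γ} (hS : Subgroup.closure (S : Set Γ) = ⊤) (g : Γ) :
    wordLength S g⁻¹ ≤ wordLength S g := by
  obtain ⟨l, h1, h2, rfl⟩ := exists_word hS g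
  rw [← h1, List.prod_inv_reverse]
  refine (wordLength_le fun s hs => ?_).trans (by simp)
  obtain ⟨t, ht, rfl⟩ : ∃ t ∈ l, t⁻¹ = s := by simpa using hs
  rw [inv_inv]
  exact (h2 t ht).symm

theorem one_le_wordLength {S : Finset Γ} (hS : Subgroup.closure (S : Set Γ) = ⊤) {g : Γ}
    (hg : g ≠ 1) : 1 ≤ wordLength S g := by
  obtain ⟨l, h1, -, rfl⟩ := exists_word hS g
  rw [← h1]
  by_contra! h
  exact hg (by simp [List.length_eq_zero_iff.1 (Nat.lt_one_iff.1 h)])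

/-- Rapid decay comes with its own generating set, while the fourth moment weight uses `S`; this
comparison passes between the two. -/
theorem exists_wordLength_le_mul {S : Finset Γ} (hS : Subgroup.closure (S : Set Γ) = ⊤)
    {S' : Finset Γ} (hS' : Subgroup.closure (S' : Set Γ) = ⊤) :
    ∃ L : ℕ, ∀ g, wordLength S' g ≤ L * wordLength S g := by
  refine ⟨S.sup (wordLength S'), fun g => ?_⟩
  obtain ⟨l, h1, h2, rfl⟩ := exists_word hS g
  rw [← h1]
  clear h1
  induction l with
  | nil => simp [wordLength_one]
  | cons s l ih =>
    have hs : wordLength S' s ≤ S.sup (wordLength S') := by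
      rcases h2 s (by simp) with hs | hs
      · exact Finset.le_sup (f := wordLength S') hs
      · have := wordLength_inv_le hS' s⁻¹
        rw [inv_inv] at this
        exact this.trans (Finset.le_sup (f := wordLength S') hs)
    have := ih fun t ht => h2 t (by simp [ht])
    rw [List.prod_cons, List.length_cons, mul_add, mul_one, add_comm]
    exact (wordLength_mul_le hS' _ _).trans (add_le_add hs this)

end WordLength

/-! ### Rapid decay as a weighted `ℓ²` bound -/

section RapidDecay

variable {Γ : Type*} [Group Γ]

/-- The restriction of `q` to the sphere of radius `n`. -/
def sphere (S : Finset Γ) (q : MonoidAlgebra ℂ Γ) (n : ℕ) : MonoidAlgebra ℂ Γ :=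
  MonoidAlgebra.ofCoeff (q.coeff.filter fun g => wordLength S g = n)

theorem support_sphere (S : Finset Γ) (q : MonoidAlgebra ℂ Γ) (n : ℕ) :
    (sphere S q n).coeff.support = q.coeff.support.filter fun g => wordLength S g = n :=
  Finsupp.support_filter _ _

theorem sum_sphere (S : Finset Γ) (q : MonoidAlgebra ℂ Γ) {R : ℕ}
    (hR : ∀ g ∈ q.coeff.support, wordLength S g < R) :
    ∑ n ∈ Finset.range R, sphere S q n = q := by
  classical
  ext g
  rw [MonoidAlgebra.coeff_sum, Finsupp.finsetSum_apply]
  simp only [sphere, Finsupp.filter_apply]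
  rw [Finset.sum_ite_eq]
  by_cases hg : g ∈ q.coeff.support
  · simp [hR g hg]
  · simp [Finsupp.notMem_support_iff.1 hg]

theorem l2norm_sphere_sq (S : Finset Γ) (q : MonoidAlgebra ℂ Γ) (n : ℕ) :
    l2norm (sphere S q n) ^ 2 =
      ∑ g ∈ q.coeff.support.filter (fun g => wordLength S g = n), ‖q.coeff g‖ ^ 2 := by
  rw [l2norm, Real.sq_sqrt (Finset.sum_nonneg fun _ _ => by positivity), support_sphere]
  refine Finset.sum_congr rfl fun g hg => ?_
  simp only [sphere, Finsupp.filter_apply, (Finset.mem_filter.1 hg).2, if_true]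

theorem diamSupp_sphere_le {S S' : Finset Γ} (hS' : Subgroup.closure (S' : Set Γ) = ⊤) {L : ℕ}
    (hL : ∀ g, wordLength S' g ≤ L * wordLength S g) (q : MonoidAlgebra ℂ Γ) (n : ℕ) :
    diamSupp S' (sphere S q n) ≤ (2 * L + 1) * (n + 1) := by
  rw [diamSupp, support_sphere]
  refine max_le (by nlinarith) (Finset.sup_le fun g hg => Finset.sup_le fun h hh => ?_)
  have h1 := hL g
  have h2 := hL h
  rw [(Finset.mem_filter.1 hg).2] at h1
  rw [(Finset.mem_filter.1 hh).2] at h2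
  have h3 := wordLength_mul_le hS' h g⁻¹
  have h4 := wordLength_inv_le hS' g
  nlinarith

/-- The weighted `ℓ²` norm square `∑_g |q_g|² (|g| + 1)^a`. -/
def wnormSq (S : Finset Γ) (a : ℝ) (q : MonoidAlgebra ℂ Γ) : ℝ :=
  ∑ g ∈ q.coeff.support, ‖q.coeff g‖ ^ 2 * ((wordLength S g : ℝ) + 1) ^ a

/-- Cut `q` into spheres. Rapid decay on the sphere of radius `n` costs `(n + 1)^{C₁}`, and
Cauchy–Schwarz against the weights `(n + 1)^{a/2}` leaves `∑ (n + 1)^{2 C₁ - a}`, which is finite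
because `a > 2 C₁ + 1`. -/
theorem exists_norm_leftRegLift_le_wnorm {C₁ : ℝ} (hRD : HasRapidDecayWith Γ C₁) {S : Finset Γ}
    (hS : Subgroup.closure (S : Set Γ) = ⊤) {a : ℝ} (ha : 2 * C₁ + 1 < a) :
    ∃ C : ℝ, 0 ≤ C ∧ ∀ q : MonoidAlgebra ℂ Γ,
      ‖leftRegLift Γ q‖ ≤ C * Real.sqrt (wnormSq S a q) := by
  obtain ⟨hC₁, S', hS', C, hC, hRD⟩ := hRD
  obtain ⟨L, hL⟩ := exists_wordLength_le_mul hS hS'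
  have hsum : Summable fun n : ℕ => ((n : ℝ) + 1) ^ (2 * C₁ - a) := by
    have := (summable_nat_add_iff 1).2 (Real.summable_nat_rpow (p := 2 * C₁ - a) |>.2 (by linarith))
    simpa using this
  set Z : ℝ := ∑' n : ℕ, ((n : ℝ) + 1) ^ (2 * C₁ - a)
  set A : ℝ := C * ((2 * L + 1 : ℕ) : ℝ) ^ C₁
  refine ⟨A * Real.sqrt Z, by positivity, fun q => ?_⟩
  obtain ⟨R, hR⟩ : ∃ R, ∀ g ∈ q.coeff.support, wordLength S g < R :=
    ⟨q.coeff.support.sup (wordLength S) + 1, fun g hg =>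
      Nat.lt_succ_of_le (Finset.le_sup (f := wordLength S) hg)⟩
  have h1 : ∀ n : ℕ, ‖leftRegLift Γ (sphere S q n)‖ ≤
      A * (((n : ℝ) + 1) ^ (C₁ - a / 2) *
        (((n : ℝ) + 1) ^ (a / 2) * l2norm (sphere S q n))) := by
    intro n
    have hn : (0 : ℝ) < (n : ℝ) + 1 := by positivity
    rw [leftRegLift_apply, ← mul_assoc (((n : ℝ) + 1) ^ (C₁ - a / 2)), ← Real.rpow_add hn,
      sub_add_cancel]
    refine (hRD _).trans ?_
    rw [← mul_assoc]
    refine mul_le_mul_of_nonneg_right ?_ (Real.sqrt_nonneg _)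
    rw [mul_assoc]
    refine mul_le_mul_of_nonneg_left ?_ hC.le
    rw [← Real.mul_rpow (by positivity) hn.le]
    refine Real.rpow_le_rpow (by positivity) ?_ hC₁.le
    exact_mod_cast diamSupp_sphere_le hS' hL q n
  have h2 : ∑ n ∈ Finset.range R, (((n : ℝ) + 1) ^ (a / 2) * l2norm (sphere S q n)) ^ 2 =
      wnormSq S a q := by
    rw [wnormSq, ← Finset.sum_fiberwise_of_maps_to (s := q.coeff.support) (t := Finset.range R)
      (g := wordLength S) (fun g hg => Finset.mem_range.2 (hR g hg))]
    refine Finset.sum_congr rfl fun n _ => ?_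
    rw [mul_pow, l2norm_sphere_sq, Finset.mul_sum]
    refine Finset.sum_congr rfl fun g hg => ?_
    rw [(Finset.mem_filter.1 hg).2, ← Real.rpow_natCast, ← Real.rpow_mul (by positivity), mul_comm]
    congr 2
    push_cast
    ring
  have h3 : ∑ n ∈ Finset.range R, (((n : ℝ) + 1) ^ (C₁ - a / 2)) ^ 2 ≤ Z := by
    refine le_trans (le_of_eq ?_) (hsum.sum_le_tsum (Finset.range R) fun _ _ => by positivity)
    refine Finset.sum_congr rfl fun n _ => ?_
    rw [← Real.rpow_natCast, ← Real.rpow_mul (by positivity)]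
    congr 1
    push_cast
    ring
  conv_lhs => rw [← sum_sphere S q hR, map_sum]
  calc _ ≤ ∑ n ∈ Finset.range R, A * (((n : ℝ) + 1) ^ (C₁ - a / 2) *
        (((n : ℝ) + 1) ^ (a / 2) * l2norm (sphere S q n))) :=
        (norm_sum_le _ _).trans (Finset.sum_le_sum fun n _ => h1 n)
    _ ≤ A * (Real.sqrt Z * Real.sqrt (wnormSq S a q)) := by
        rw [← Finset.mul_sum]
        refine mul_le_mul_of_nonneg_left ?_ (by positivity)
        refine (Real.sum_mul_le_sqrt_mul_sqrt _ _ _).trans ?_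
        rw [h2]
        gcongr
    _ = _ := by ring

end RapidDecay

/-! ### The Poisson kernel and its polynomial approximation -/

section Poisson

/-- The Poisson kernel `η / ((t - E)² + η²)`. -/
def pker (E η t : ℝ) : ℝ := η / ((t - E) ^ 2 + η ^ 2)

theorem pker_nonneg {η : ℝ} (hη : 0 < η) (E t : ℝ) : 0 ≤ pker E η t := by
  unfold pker; positivity

theorem pker_le {η : ℝ} (hη : 0 < η) (E t : ℝ) : pker E η t ≤ 1 / η := by
  unfold pker
  rw [div_le_div_iff₀ (by positivity) hη]
  nlinarith [sq_nonneg (t - E)]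

theorem continuous_pker {η : ℝ} (hη : 0 < η) (E : ℝ) : Continuous (pker E η) := by
  unfold pker
  exact continuous_const.div (by fun_prop) fun t => by positivity

/-- Near `E`, the Poisson kernel is at least `1 / (5 η)`. -/
theorem one_le_five_mul_pker {E η t : ℝ} (hη : 0 < η) (ht : |t - E| ≤ 2 * η) :
    1 ≤ 5 * η * pker E η t := by
  unfold pker
  rw [← mul_div_assoc, le_div_iff₀ (by positivity)]
  nlinarith [sq_le_sq' (abs_le.1 ht).1 (abs_le.1 ht).2]

/-- A combination of two Poisson kernels that is a lower bound for an indicator function. -/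
theorem pker_sub_le_indicator {E η M t : ℝ} (hη : 0 < η) (hM : 1 ≤ M) :
    η * (pker E η t - 2 / M * pker E (M * η) t) ≤ if |t - E| ≤ M * η then 1 else 0 := by
  have hM0 : 0 < M := by linarith
  split_ifs with h
  · have h1 := pker_le hη E t
    have h2 := pker_nonneg (mul_pos hM0 hη) E t
    have h3 : η * pker E η t ≤ 1 := by
      rw [le_div_iff₀ hη] at h1; linarith
    have : 0 ≤ 2 / M * pker E (M * η) t := by positivity
    nlinarith
  · push Not at h
    have h1 : (M * η) ^ 2 ≤ (t - E) ^ 2 := by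
      rw [← sq_abs (t - E)]
      gcongr
    -- The second term is `2 η / ((t - E)² + M² η²)`; outside the window its denominator is at most
    -- twice that of `pker E η t`.
    have h2 : pker E η t ≤ 2 / M * pker E (M * η) t := by
      unfold pker
      rw [div_mul_div_comm, div_le_div_iff₀ (by positivity) (by positivity)]
      have : 0 ≤ η * M * ((t - E) ^ 2 - (M * η) ^ 2 + 2 * η ^ 2) := by
        have : 0 ≤ (t - E) ^ 2 - (M * η) ^ 2 + 2 * η ^ 2 := by nlinarith [sq_nonneg η]
        positivity
      nlinarith
    nlinarith

open Polynomial in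
/-- A polynomial approximation of the Poisson kernel (a truncated Neumann series). -/
def poissonPoly (M E η : ℝ) (n : ℕ) : Polynomial ℝ :=
  C (η / M) * ∑ k ∈ Finset.range n, (1 - C (1 / M) * ((X - C E) ^ 2 + C (η ^ 2))) ^ k

/-- With `D = (t - E)² + η²` this is the geometric series for `1 / D` in powers of `1 - D / M`. The
error is a relative factor, which gives sign and accuracy at once when `D ≤ M`. -/
theorem poissonPoly_eval {M E η : ℝ} (hM : 0 < M) (hη : 0 < η) (n : ℕ) (t : ℝ) :
    (poissonPoly M E η n).eval t =
      pker E η t * (1 - (1 - ((t - E) ^ 2 + η ^ 2) / M) ^ n) := by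
  have hD : 0 < (t - E) ^ 2 + η ^ 2 := by positivity
  have hg := mul_neg_geom_sum (1 - ((t - E) ^ 2 + η ^ 2) / M) n
  rw [sub_sub_cancel] at hg
  simp only [poissonPoly, Polynomial.eval_mul, Polynomial.eval_C, Polynomial.eval_finsetSum,
    Polynomial.eval_pow, Polynomial.eval_sub, Polynomial.eval_one, Polynomial.eval_add,
    Polynomial.eval_X, one_div_mul_eq_div]
  rw [← hg, pker]
  field_simp

theorem poissonPoly_bounds {M E η t : ℝ} (hη : 0 < η)
    (hD : (t - E) ^ 2 + η ^ 2 ≤ M) (n : ℕ) :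
    0 ≤ (1 - ((t - E) ^ 2 + η ^ 2) / M) ^ n ∧
      (1 - ((t - E) ^ 2 + η ^ 2) / M) ^ n ≤ (1 - η ^ 2 / M) ^ n := by
  have hM : 0 < M := lt_of_lt_of_le (by positivity) hD
  have h0 : 0 ≤ 1 - ((t - E) ^ 2 + η ^ 2) / M := by
    rw [sub_nonneg, div_le_one hM]; exact hD
  refine ⟨by positivity, ?_⟩
  gcongr
  nlinarith [sq_nonneg (t - E)]

theorem abs_poissonPoly_sub_le {M E η t : ℝ} (hη : 0 < η)
    (hD : (t - E) ^ 2 + η ^ 2 ≤ M) (n : ℕ) :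
    |(poissonPoly M E η n).eval t - pker E η t| ≤ 1 / η * (1 - η ^ 2 / M) ^ n := by
  have hM : 0 < M := lt_of_lt_of_le (by positivity) hD
  obtain ⟨h1, h2⟩ := poissonPoly_bounds hη hD n
  rw [poissonPoly_eval hM hη, mul_one_sub, sub_sub_cancel_left, abs_neg, abs_mul,
    abs_of_nonneg (pker_nonneg hη _ _), abs_of_nonneg h1]
  exact mul_le_mul (pker_le hη _ _) h2 h1 (by positivity)

theorem poissonPoly_nonneg {M E η t : ℝ} (hη : 0 < η)
    (hD : (t - E) ^ 2 + η ^ 2 ≤ M) (n : ℕ) : 0 ≤ (poissonPoly M E η n).eval t := by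
  have hM : 0 < M := lt_of_lt_of_le (by positivity) hD
  obtain ⟨h1, h2⟩ := poissonPoly_bounds hη hD n
  rw [poissonPoly_eval hM hη]
  refine mul_nonneg (pker_nonneg hη _ _) (sub_nonneg.2 (h2.trans (pow_le_one₀ ?_ ?_)))
  · rw [sub_nonneg, div_le_one hM]
    nlinarith [sq_nonneg (t - E)]
  · have : 0 ≤ η ^ 2 / M := by positivity
    linarith

/-- The truncation keeps at least half of the kernel, so the constant 5 becomes 10. -/
theorem one_le_poissonPoly {M E η t : ℝ} (hη : 0 < η)
    (hD : (t - E) ^ 2 + η ^ 2 ≤ M) {n : ℕ} (hn : (1 - η ^ 2 / M) ^ n ≤ 1 / 2)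
    (ht : |t - E| ≤ 2 * η) : 1 ≤ 10 * η * (poissonPoly M E η n).eval t := by
  have hM : 0 < M := lt_of_lt_of_le (by positivity) hD
  obtain ⟨h1, h2⟩ := poissonPoly_bounds hη hD n
  rw [poissonPoly_eval hM hη]
  have h3 := one_le_five_mul_pker hη ht
  nlinarith

end Poisson

/-! ### The imaginary part of the resolvent by functional calculus -/

section Resolvent

theorem norm_le_of_mem_spectrum {A : Type*} [CStarAlgebra A] [Nontrivial A] {a : A} {t : ℝ}
    (ht : t ∈ spectrum ℝ a) : |t| ≤ ‖a‖ := by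
  have := spectrum.norm_le_norm_mul_of_mem ht
  rwa [norm_one, mul_one] at this

/-- In a C*-algebra, the truncated Neumann series approximates `η (a - z)⁻¹ (a - z̄)⁻¹`. -/
theorem norm_aeval_poissonPoly_sub_le {A : Type*} [CStarAlgebra A] [Nontrivial A] {a : A}
    (ha : IsSelfAdjoint a) {E η M : ℝ} (hη : 0 < η) (u v : Aˣ)
    (hu : (u : A) = a - ((E : ℂ) + (η : ℂ) * Complex.I) • (1 : A))
    (hv : (v : A) = a - ((E : ℂ) - (η : ℂ) * Complex.I) • (1 : A))
    (hM : ∀ t : ℝ, |t| ≤ ‖a‖ → (t - E) ^ 2 + η ^ 2 ≤ M) (n : ℕ) :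
    ‖Polynomial.aeval a ((poissonPoly M E η n).map (algebraMap ℝ ℂ)) -
      (η : ℂ) • ((↑u⁻¹ : A) * ↑v⁻¹)‖ ≤ 1 / η * (1 - η ^ 2 / M) ^ n := by
  -- The product `(a - z̄)(a - z)` is the function `(t - E)² + η²` of `a`, so `η (a - z)⁻¹ (a -
  -- z̄)⁻¹` is the Poisson kernel of `a`, and the scalar estimate on the spectrum suffices.
  have hvu : (v : A) * u = cfc (fun t : ℝ => (t - E) ^ 2 + η ^ 2) a := by
    have h1 : cfc (fun t : ℝ => (t - E) ^ 2 + η ^ 2) a =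
        (a - algebraMap ℝ _ E) ^ 2 + algebraMap ℝ _ (η ^ 2) := by
      rw [cfc_add_const (η ^ 2) (fun t : ℝ => (t - E) ^ 2) a, cfc_pow (fun t : ℝ => t - E) 2 a,
        cfc_sub (fun t : ℝ => t) (fun _ => E) a, cfc_id' ℝ a, cfc_const E a]
    have h2 : ∀ r : ℝ, algebraMap ℝ A r = (r : ℂ) • (1 : A) := fun r => by
      rw [Algebra.algebraMap_eq_smul_one]; exact (Complex.coe_smul r (1 : A)).symm
    rw [h1, hu, hv, h2, h2, pow_two]
    simp only [sub_mul, mul_sub, smul_mul_assoc, mul_smul_comm, one_mul, mul_one, smul_smul,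
      smul_sub, mul_add, sub_smul, add_smul]
    have h3 : ((η : ℂ) * Complex.I) * ((η : ℂ) * Complex.I) = -((η ^ 2 : ℝ) : ℂ) := by
      push_cast
      linear_combination (η : ℂ) ^ 2 * Complex.I_mul_I
    rw [h3, neg_smul, mul_comm ((η : ℂ) * Complex.I) (E : ℂ)]
    abel
  have hc : cfc (pker E η) a * ((v : A) * u) = (η : ℂ) • 1 := by
    rw [hvu, ← cfc_mul (pker E η) (fun t : ℝ => (t - E) ^ 2 + η ^ 2) a
      (continuous_pker hη E).continuousOn]
    have : (fun t => pker E η t * ((t - E) ^ 2 + η ^ 2)) = fun _ => η := by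
      ext t
      have : (t - E) ^ 2 + η ^ 2 ≠ 0 := by positivity
      rw [pker, div_mul_cancel₀ _ this]
    rw [this, cfc_const η a, Algebra.algebraMap_eq_smul_one]
    exact (Complex.coe_smul η (1 : A)).symm
  have him : (η : ℂ) • ((↑u⁻¹ : A) * ↑v⁻¹) = cfc (pker E η) a :=
    calc _ = ((η : ℂ) • 1) * ((↑u⁻¹ : A) * ↑v⁻¹) := by rw [smul_mul_assoc, one_mul]
      _ = cfc (pker E η) a := by
        rw [← hc, mul_assoc, mul_assoc, ← mul_assoc (u : A), Units.mul_inv,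
          one_mul, Units.mul_inv, mul_one]
  rw [him, Polynomial.aeval_map_algebraMap, ← cfc_polynomial (poissonPoly M E η n) a,
    ← cfc_sub _ _ _ (by fun_prop) (continuous_pker hη E).continuousOn]
  have h0 := hM 0 (by simp)
  have hη2 : η ^ 2 ≤ M := by nlinarith [sq_nonneg (0 - E)]
  have hM0 : 0 < M := lt_of_lt_of_le (by positivity) hη2
  have h2 : 0 ≤ 1 - η ^ 2 / M := by
    rw [sub_nonneg, div_le_one hM0]; exact hη2
  refine norm_cfc_le (by positivity) fun t ht => ?_
  exact abs_poissonPoly_sub_le hη (hM t (norm_le_of_mem_spectrum ht)) n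

variable {Γ : Type*} [Group Γ]

theorem isSelfAdjoint_leftRegLift {p : MonoidAlgebra ℂ Γ}
    (hp : ∀ g, p.coeff g⁻¹ = (starRingEnd ℂ) (p.coeff g)) : IsSelfAdjoint (leftRegLift Γ p) := by
  rw [IsSelfAdjoint, adjoint_leftRegLift]
  congr 1
  ext g
  rw [adj_coeff, hp, Complex.conj_conj]

/-- The resolvent identity `R - R* = R (z - z̄) R*`, where `R` and `R*` are the inverses of `u = P -
z` and `v = P - z̄`. Both are invertible since the spectrum of `P` is real. -/
theorem exists_imOp_resolv {P : Ell2 Γ →L[ℂ] Ell2 Γ} (hP : IsSelfAdjoint P) (E : ℝ) {η : ℝ}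
    (hη : 0 < η) : ∃ u v : (Ell2 Γ →L[ℂ] Ell2 Γ)ˣ,
      (u : Ell2 Γ →L[ℂ] Ell2 Γ) = P - ((E : ℂ) + (η : ℂ) * Complex.I) • 1 ∧
      (v : Ell2 Γ →L[ℂ] Ell2 Γ) = P - ((E : ℂ) - (η : ℂ) * Complex.I) • 1 ∧
      imOp (resolv P ((E : ℂ) + (η : ℂ) * Complex.I)) =
        (η : ℂ) • ((↑u⁻¹ : Ell2 Γ →L[ℂ] Ell2 Γ) * ↑v⁻¹) := by
  set z : ℂ := (E : ℂ) + (η : ℂ) * Complex.I with hz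
  have hz' : (E : ℂ) - (η : ℂ) * Complex.I = star z := by
    apply Complex.ext <;> simp [z]
  have hzi : z.im = η := by simp [z]
  have hzi' : (star z).im = -η := by simp [z]
  have hid : ContinuousLinearMap.id ℂ (Ell2 Γ) = 1 := rfl
  have key : ∀ w : ℂ, w.im ≠ 0 → IsUnit (P - w • (1 : Ell2 Γ →L[ℂ] Ell2 Γ)) := by
    intro w hw
    have : w ∉ spectrum ℂ P := fun h => hw (by rw [hP.mem_spectrum_eq_re h]; simp)
    rw [spectrum.notMem_iff, Algebra.algebraMap_eq_smul_one] at this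
    rw [← neg_sub]; exact this.neg
  obtain ⟨u, hu⟩ := key z (by rw [hzi]; exact hη.ne')
  obtain ⟨v, hv⟩ := key (star z) (by rw [hzi']; exact (neg_neg_of_pos hη).ne)
  refine ⟨u, v, hu, by rw [hz', hv], ?_⟩
  have hR : resolv P z = ↑u⁻¹ := by
    rw [resolv, hid, ← hu, Ring.inverse_unit]
  have hstar : star (u : Ell2 Γ →L[ℂ] Ell2 Γ) = v := by
    rw [hu, hv, star_sub, hP.star_eq, star_smul, star_one]
  have hR' : ContinuousLinearMap.adjoint (resolv P z) = ↑v⁻¹ := by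
    rw [hR, ← ContinuousLinearMap.star_eq_adjoint]
    have : star u = v := Units.ext hstar
    rw [← this, ← Units.coe_star, star_inv]
  have hcomm : (v : Ell2 Γ →L[ℂ] Ell2 Γ) - u = (2 * Complex.I * η) • 1 := by
    rw [hu, hv, sub_sub_sub_cancel_left, ← sub_smul]
    congr 1
    apply Complex.ext <;> simp [z]
    ring
  have : (↑u⁻¹ : Ell2 Γ →L[ℂ] Ell2 Γ) - ↑v⁻¹ =
      ↑u⁻¹ * ((v : Ell2 Γ →L[ℂ] Ell2 Γ) - u) * ↑v⁻¹ := by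
    rw [mul_sub, sub_mul, mul_assoc, Units.mul_inv, mul_one, Units.inv_mul, one_mul]
  rw [imOp, hR', hR, this, hcomm, mul_smul_comm, mul_one, smul_mul_assoc, smul_smul]
  congr 1
  field_simp

/-- The element of the group algebra that approximates the imaginary part of the resolvent. -/
def poissonElt (p : MonoidAlgebra ℂ Γ) (M E η : ℝ) (n : ℕ) : MonoidAlgebra ℂ Γ :=
  Polynomial.aeval p ((poissonPoly M E η n).map (algebraMap ℝ ℂ))

instance : Nontrivial (Ell2 Γ →L[ℂ] Ell2 Γ) :=
  ⟨1, 0, fun h => by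
    have := congrArg (fun Q : Ell2 Γ →L[ℂ] Ell2 Γ => ‖Q (delta 1)‖) h
    simp [norm_delta] at this⟩

/-- The number `l1norm p` bounds `λ(p)` and every `ρ_N(p)`, so the same `M`, and thus the same
polynomial, serves on both sides. -/
theorem norm_leftRegLift_poissonElt_sub_le {p : MonoidAlgebra ℂ Γ}
    (hp : ∀ g, p.coeff g⁻¹ = (starRingEnd ℂ) (p.coeff g)) {M E η : ℝ} (hη : 0 < η)
    (hM : ∀ t : ℝ, |t| ≤ l1norm p → (t - E) ^ 2 + η ^ 2 ≤ M) (n : ℕ) :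
    ‖leftRegLift Γ (poissonElt p M E η n) -
      imOp (resolv (leftRegAlg p) ((E : ℂ) + (η : ℂ) * Complex.I))‖ ≤
      1 / η * (1 - η ^ 2 / M) ^ n := by
  obtain ⟨u, v, hu, hv, h⟩ := exists_imOp_resolv (isSelfAdjoint_leftRegLift hp) E hη
  rw [← leftRegLift_apply, h, poissonElt, ← Polynomial.aeval_algHom_apply]
  exact norm_aeval_poissonPoly_sub_le (isSelfAdjoint_leftRegLift hp) hη u v hu hv
    (fun t ht => hM t (ht.trans (norm_leftRegLift_le p))) n

theorem adjoint_imOp (R : Ell2 Γ →L[ℂ] Ell2 Γ) :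
    ContinuousLinearMap.adjoint (imOp R) = imOp R := by
  rw [imOp, map_smulₛₗ, map_sub, ContinuousLinearMap.adjoint_adjoint, ← neg_sub, smul_neg,
    ← neg_smul]
  congr 1
  simp [Complex.conj_ofNat]

/-- `Im R^{E+iη}` is self-adjoint: its first row and its first column agree up to conjugation. -/
theorem norm_imRes_one_left {p : MonoidAlgebra ℂ Γ} (E η : ℝ) (g : Γ) :
    ‖imRes p E η 1 g‖ = ‖(imOp (resolv (leftRegAlg p)
      ((E : ℂ) + (η : ℂ) * Complex.I)) (delta 1) : Γ → ℂ) g‖ := by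
  rw [← entry_eq, imRes, entry, ← ContinuousLinearMap.adjoint_inner_left, adjoint_imOp,
    ← inner_conj_symm, RCLike.norm_conj]
  rfl

end Resolvent

/-! ### Traces, quadratic forms and large singular values of matrices -/

section Eigenbasis

variable {N : ℕ}

theorem trace_eq_sum_inner (A : Matrix (Fin N) (Fin N) ℂ)
    (b : OrthonormalBasis (Fin N) ℂ (EuclideanSpace ℂ (Fin N))) :
    A.trace = ∑ i, inner ℂ (b i) (Matrix.toEuclideanLin A (b i)) := by
  rw [← LinearMap.trace_eq_sum_inner, Matrix.toEuclideanLin, Matrix.toLpLin_eq_toLin,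
    Matrix.trace_toLin_eq]

/-- The quadratic form of an operator that is diagonal in an orthonormal basis. -/
theorem inner_apply_eq_sum {A : Matrix (Fin N) (Fin N) ℂ}
    {b : OrthonormalBasis (Fin N) ℂ (EuclideanSpace ℂ (Fin N))} {μ : Fin N → ℝ}
    (hb : ∀ i, Matrix.toEuclideanLin A (b i) = (μ i : ℂ) • b i) (v : EuclideanSpace ℂ (Fin N)) :
    inner ℂ v (Matrix.toEuclideanLin A v) = ((∑ i, μ i * ‖inner ℂ (b i) v‖ ^ 2 : ℝ) : ℂ) := by
  have h : Matrix.toEuclideanLin A v = ∑ i, inner ℂ (b i) v • (μ i : ℂ) • b i := by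
    conv_lhs => rw [← b.sum_repr' v]
    simp [hb]
  rw [h, inner_sum]
  push_cast
  refine Finset.sum_congr rfl fun i _ => ?_
  rw [inner_smul_right, inner_smul_right, ← inner_conj_symm v (b i), ← Complex.mul_conj']
  ring

theorem toEuclideanLin_pow_apply {A : Matrix (Fin N) (Fin N) ℂ} {v : EuclideanSpace ℂ (Fin N)}
    {c : ℂ} (h : Matrix.toEuclideanLin A v = c • v) (m : ℕ) :
    Matrix.toEuclideanLin (A ^ m) v = c ^ m • v := by
  induction m with
  | zero => simp
  | succ m ih =>
    rw [pow_succ, Matrix.toLpLin_mul_same, LinearMap.comp_apply, h, map_smul, ih, smul_smul,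
      pow_succ, mul_comm]

theorem toEuclideanLin_mul_apply (A B : Matrix (Fin N) (Fin N) ℂ) (v : EuclideanSpace ℂ (Fin N)) :
    Matrix.toEuclideanLin (A * B) v = Matrix.toEuclideanLin A (Matrix.toEuclideanLin B v) := by
  rw [Matrix.toLpLin_mul_same, LinearMap.comp_apply]

theorem inner_conjTranspose_apply (A : Matrix (Fin N) (Fin N) ℂ)
    (v w : EuclideanSpace ℂ (Fin N)) :
    inner ℂ v (Matrix.toEuclideanLin A.conjTranspose w) =
      inner ℂ (Matrix.toEuclideanLin A v) w := by
  rw [Matrix.toEuclideanLin_conjTranspose_eq_adjoint, LinearMap.adjoint_inner_right]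

open scoped ComplexOrder in
/-- The singular vectors of `A` with singular value above `κ` span a subspace whose dimension is
controlled by the moments of `A* A`. -/
theorem exists_submodule_singular (A : Matrix (Fin N) (Fin N) ℂ) {κ : ℝ} (hκ : 0 < κ) :
    ∃ H : Submodule ℂ (EuclideanSpace ℂ (Fin N)),
      (∀ m : ℕ, (Module.finrank ℂ H : ℝ) * (κ ^ 2) ^ m ≤
        ((A.conjTranspose * A) ^ m).trace.re) ∧
      ∀ v ∈ Hᗮ, ‖Matrix.toEuclideanLin A v‖ ≤ κ * ‖v‖ := by
  classical
  set B := A.conjTranspose * A with hB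
  have hpos : B.PosSemidef := Matrix.posSemidef_conjTranspose_mul_self A
  set b := hpos.isHermitian.eigenvectorBasis
  set μ := hpos.isHermitian.eigenvalues
  have hμ : ∀ i, 0 ≤ μ i := hpos.eigenvalues_nonneg
  have hb : ∀ i, Matrix.toEuclideanLin B (b i) = (μ i : ℂ) • b i := by
    intro i
    ext x
    have := congrFun (hpos.isHermitian.mulVec_eigenvectorBasis i) x
    simpa [Matrix.toLpLin_apply] using this
  set J := Finset.univ.filter fun i => κ ^ 2 < μ i
  refine ⟨Submodule.span ℂ (J.image b : Finset _), fun m => ?_, fun v hv => ?_⟩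
  · have h1 : (Module.finrank ℂ (Submodule.span ℂ ((J.image b : Finset _) :
        Set (EuclideanSpace ℂ (Fin N)))) : ℝ) ≤ J.card := by
      exact_mod_cast (finrank_span_finset_le_card (R := ℂ) (J.image b)).trans Finset.card_image_le
    have h2 : ((B ^ m).trace).re = ∑ i, μ i ^ m := by
      rw [trace_eq_sum_inner (B ^ m) b, Complex.re_sum]
      refine Finset.sum_congr rfl fun i _ => ?_
      rw [toEuclideanLin_pow_apply (hb i), inner_smul_right, inner_self_eq_norm_sq_to_K,
        b.norm_eq_one]
      simp [← Complex.ofReal_pow]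
    rw [h2]
    calc _ ≤ (J.card : ℝ) * (κ ^ 2) ^ m := by gcongr
      _ = ∑ i ∈ J, (κ ^ 2) ^ m := by simp
      _ ≤ ∑ i ∈ J, μ i ^ m := Finset.sum_le_sum fun i hi => by
          have := (Finset.mem_filter.1 hi).2
          gcongr
      _ ≤ ∑ i, μ i ^ m := Finset.sum_le_univ_sum_of_nonneg fun i => pow_nonneg (hμ i) m
  · have h0 : ∀ i, κ ^ 2 < μ i → inner ℂ (b i) v = 0 := fun i hi =>
      Submodule.inner_right_of_mem_orthogonal (Submodule.subset_span (by
        simpa using ⟨i, Finset.mem_filter.2 ⟨Finset.mem_univ _, hi⟩, rfl⟩)) hv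
    have h1 : ‖Matrix.toEuclideanLin A v‖ ^ 2 = ∑ i, μ i * ‖inner ℂ (b i) v‖ ^ 2 := by
      have := inner_apply_eq_sum hb v
      rw [hB, toEuclideanLin_mul_apply, inner_conjTranspose_apply,
        inner_self_eq_norm_sq_to_K, ← RCLike.ofReal_pow] at this
      exact Complex.ofReal_injective this
    refine le_of_sq_le_sq ?_ (by positivity)
    rw [h1, mul_pow, ← b.sum_sq_norm_inner_right v, Finset.mul_sum]
    refine Finset.sum_le_sum fun i _ => ?_
    rcases lt_or_ge (κ ^ 2) (μ i) with h | h
    · simp [h0 i h]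
    · gcongr

end Eigenbasis

/-! ### Exceptional subspaces of dimension `o(N)` -/

section SmallSubspaces

variable {Γ : Type*} [Group Γ]

/-- Moment method: the normalized trace of `(ρ(w)* ρ(w))^m` tends to the coefficient of `(w* w)^m`
at the identity, which is at most `‖λ(w)‖^{2m}`. By Markov's inequality the proportion of singular
values above `κ` has upper limit at most `(‖λ(w)‖ / κ)^{2m}`. The subspace does not depend on `m`,
so `m` may be as large as desired. -/
theorem exists_submodule_permLift {N : ℕ → ℕ} (hN : Tendsto N atTop atTop)
    {ρ : ∀ n, Γ →* Equiv.Perm (Fin (N n))} (hρ : ConvDistr ρ) (w : MonoidAlgebra ℂ Γ) {κ : ℝ}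
    (hκ : ‖leftRegLift Γ w‖ < κ) :
    ∃ H : ∀ n, Submodule ℂ (EuclideanSpace ℂ (Fin (N n))),
      Tendsto (fun n => (Module.finrank ℂ (H n) : ℝ) / (N n : ℝ)) atTop (𝓝 0) ∧
      ∀ n, ∀ v ∈ (H n)ᗮ, ‖Matrix.toEuclideanLin (permLift (ρ n) w) v‖ ≤ κ * ‖v‖ := by
  have hκ0 : 0 < κ := (norm_nonneg _).trans_lt hκ
  choose H hH hH' using fun n => exists_submodule_singular (permLift (ρ n) w) hκ0
  refine ⟨H, ?_, hH'⟩
  set u := adj w * w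
  set s : ℝ := (‖leftRegLift Γ w‖ / κ) ^ 2
  have hs : s < 1 := by
    refine pow_lt_one₀ (by positivity) ?_ two_ne_zero
    rwa [div_lt_one hκ0]
  have hu : ∀ m : ℕ, ‖(u ^ m).coeff 1‖ ≤ (‖leftRegLift Γ w‖ ^ 2) ^ m := by
    intro m
    refine (norm_coeff_le _ _).trans ?_
    rw [map_pow, map_mul, ← adjoint_leftRegLift, sq, ← CStarRing.norm_star_mul_self]
    exact norm_pow_le _ m
  rw [Metric.tendsto_atTop']
  intro ε hε
  obtain ⟨m, hm⟩ := exists_pow_lt_of_lt_one hε hs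
  have hlim : Tendsto (fun n => ‖(permLift (ρ n) (u ^ m)).trace / (N n : ℂ)‖ / (κ ^ 2) ^ m) atTop
      (𝓝 (‖(u ^ m).coeff 1‖ / (κ ^ 2) ^ m)) :=
    (tendsto_trace_permLift hN hρ (u ^ m)).norm.div_const _
  have hlt : ‖(u ^ m).coeff 1‖ / (κ ^ 2) ^ m < ε := by
    refine lt_of_le_of_lt ?_ hm
    simp only [s, div_pow]
    gcongr
    exact hu m
  obtain ⟨n₀, hn₀⟩ := eventually_atTop.1 (hlim.eventually_lt_const hlt)
  refine ⟨n₀, fun n hn => ?_⟩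
  rw [Real.dist_eq, sub_zero, abs_of_nonneg (by positivity)]
  refine lt_of_le_of_lt ?_ (hn₀ n hn.le)
  rw [norm_div, Complex.norm_natCast, div_right_comm]
  refine div_le_div_of_nonneg_right ?_ (Nat.cast_nonneg _)
  rw [le_div_iff₀ (by positivity)]
  refine (hH n m).trans ?_
  rw [conjTranspose_permLift, ← map_mul, ← map_pow]
  exact Complex.re_le_norm _

theorem finrank_finset_sup_le {V ι : Type*} [AddCommGroup V] [Module ℂ V] [FiniteDimensional ℂ V]
    (F : Finset ι) (H : ι → Submodule ℂ V) :
    Module.finrank ℂ (F.sup H : Submodule ℂ V) ≤ ∑ i ∈ F, Module.finrank ℂ (H i) := by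
  classical
  induction F using Finset.induction_on with
  | empty => simp
  | insert i F hi ih =>
    rw [Finset.sup_insert, Finset.sum_insert hi]
    exact (Submodule.finrank_add_le_finrank_add_finrank _ _).trans (by gcongr)

/-- Countably many sequences of subspaces of dimension `o(N)` are eventually contained in a single
one. -/
theorem exists_submodule_diagonal {ι : Type*} [Countable ι] {N : ℕ → ℕ}
    (H : ι → ∀ n, Submodule ℂ (EuclideanSpace ℂ (Fin (N n))))
    (hH : ∀ i, Tendsto (fun n => (Module.finrank ℂ (H i n) : ℝ) / (N n : ℝ)) atTop (𝓝 0)) :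
    ∃ H' : ∀ n, Submodule ℂ (EuclideanSpace ℂ (Fin (N n))),
      Tendsto (fun n => (Module.finrank ℂ (H' n) : ℝ) / (N n : ℝ)) atTop (𝓝 0) ∧
      ∀ i, ∀ᶠ n in atTop, H i n ≤ H' n := by
  rcases isEmpty_or_nonempty ι with hι | hι
  · exact ⟨fun n => ⊥, by simp, fun i => (hι.false i).elim⟩
  obtain ⟨f, hf⟩ := exists_surjective_nat ι
  set s : ℕ → ℕ → ℝ := fun k n =>
    ∑ j ∈ Finset.range k, (Module.finrank ℂ (H (f j) n) : ℝ) / (N n : ℝ) with hs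
  have hs0 : ∀ k, Tendsto (s k) atTop (𝓝 0) := fun k => by
    simpa using tendsto_finsetSum (Finset.range k) fun j _ => hH (f j)
  classical
  -- The largest `k ≤ n` for which the first `k` subspaces together fill a proportion at most `1 /
  -- (k + 1)`; `k = 0` always qualifies, as the sum is then empty.
  set K : ℕ → ℕ := fun n => Nat.findGreatest (fun k => s k n ≤ 1 / ((k : ℝ) + 1)) n
  have hK : Tendsto K atTop atTop := by
    rw [tendsto_atTop]
    intro k
    filter_upwards [(hs0 k).eventually_le_const (u := 1 / ((k : ℝ) + 1)) (by positivity),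
      eventually_ge_atTop k] with n h1 h2
    exact Nat.le_findGreatest h2 h1
  have hKs : ∀ n, s (K n) n ≤ 1 / ((K n : ℝ) + 1) := fun n =>
    Nat.findGreatest_spec (P := fun k => s k n ≤ 1 / ((k : ℝ) + 1)) (Nat.zero_le n) (by simp [hs])
  refine ⟨fun n => (Finset.range (K n)).sup fun j => H (f j) n, ?_, fun i => ?_⟩
  · refine squeeze_zero (fun n => by positivity) (fun n => ?_)
      (tendsto_one_div_add_atTop_nhds_zero_nat.comp hK)
    refine le_trans ?_ (hKs n)
    simp only [hs]
    rw [← Finset.sum_div]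
    gcongr
    exact_mod_cast finrank_finset_sup_le _ _
  · obtain ⟨j, rfl⟩ := hf i
    filter_upwards [hK.eventually_gt_atTop j] with n hn
    exact Finset.le_sup (f := fun j => H (f j) n) (Finset.mem_range.2 hn)

theorem trace_permMat {N : ℕ} (ρ : Γ →* Equiv.Perm (Fin N)) (g : Γ) :
    (permMat ρ g).trace = ((Finset.univ.filter fun x => x = ρ g x).card : ℂ) := by
  simp [Matrix.trace, permMat]

/-- The points at which two distinct elements of `T` have the same action. -/
def collisions [DecidableEq Γ] {N : ℕ} (ρ : Γ →* Equiv.Perm (Fin N)) (T : Finset Γ) :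
    Finset (Fin N) :=
  T.offDiag.biUnion fun q => Finset.univ.filter fun y => y = ρ (q.1⁻¹ * q.2) y

/-- A union bound over the pairs `t ≠ t'`: they collide at the fixed points of `t⁻¹ t' ≠ e`, of
which there are `o(N)`. -/
theorem tendsto_card_collisions [DecidableEq Γ] {N : ℕ → ℕ}
    {ρ : ∀ n, Γ →* Equiv.Perm (Fin (N n))} (hρ : ConvDistr ρ) (T : Finset Γ) :
    Tendsto (fun n => ((collisions (ρ n) T).card : ℝ) / (N n : ℝ)) atTop (𝓝 0) := by
  have hlim : Tendsto (fun n => ∑ q ∈ T.offDiag,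
      ‖(permMat (ρ n) (q.1⁻¹ * q.2)).trace / (N n : ℂ)‖) atTop (𝓝 0) := by
    have := tendsto_finsetSum T.offDiag fun q (hq : q ∈ T.offDiag) =>
      (hρ (q.1⁻¹ * q.2) (by
        rw [Ne, inv_mul_eq_one]; exact (Finset.mem_offDiag.1 hq).2.2)).norm
    simpa using this
  refine squeeze_zero (fun n => by positivity) (fun n => ?_) hlim
  simp only [trace_permMat, norm_div, Complex.norm_natCast]
  rw [← Finset.sum_div]
  gcongr
  exact_mod_cast Finset.card_biUnion_le

/-- The constant vector with entries `1`. -/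
def ones (N : ℕ) : EuclideanSpace ℂ (Fin N) := WithLp.toLp 2 fun _ => 1

theorem inner_ones_left {N : ℕ} (v : EuclideanSpace ℂ (Fin N)) :
    inner ℂ (ones N) v = ∑ x, v x := by
  simp [ones, PiLp.inner_apply]

theorem tendsto_finrank_span_ones {N : ℕ → ℕ} (hN : Tendsto N atTop atTop) :
    Tendsto (fun n => (Module.finrank ℂ (Submodule.span ℂ {ones (N n)}) : ℝ) / (N n : ℝ))
      atTop (𝓝 0) := by
  refine squeeze_zero (fun n => by positivity) (fun n => ?_)
    (tendsto_one_div_atTop_nhds_zero_nat.comp hN)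
  simp only [Function.comp_apply]
  gcongr
  have := finrank_span_finset_le_card (R := ℂ) ({ones (N n)} : Finset _)
  rw [Finset.coe_singleton, Finset.card_singleton] at this
  exact_mod_cast this

/-- If `H` contains the constants and `v` is orthogonal to the part of `H` that is orthogonal to
the constants, then `v` minus its mean is orthogonal to `H`. -/
theorem sub_mean_mem_orthogonal {N : ℕ} (hN : 0 < N)
    {H : Submodule ℂ (EuclideanSpace ℂ (Fin N))} (h1 : ones N ∈ H)
    {v : EuclideanSpace ℂ (Fin N)} (hv : v ∈ (H ⊓ (Submodule.span ℂ {ones N})ᗮ)ᗮ) :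
    v - ((∑ x, v x) / (N : ℂ)) • ones N ∈ Hᗮ := by
  have hN0 : (N : ℂ) ≠ 0 := by exact_mod_cast hN.ne'
  have h11 : inner ℂ (ones N) (ones N) = (N : ℂ) := by
    rw [inner_ones_left]; simp [ones]
  rw [Submodule.mem_orthogonal]
  intro h hh
  -- Split `h` into a constant and a part orthogonal to the constants, which still lies in `H`; the
  -- centred vector is orthogonal to both.
  set c : ℂ := inner ℂ (ones N) h / (N : ℂ)
  have hc : inner ℂ (ones N) (h - c • ones N) = 0 := by
    rw [inner_sub_right, inner_smul_right, h11, div_mul_cancel₀ _ hN0, sub_self]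
  have hmem : h - c • ones N ∈ H ⊓ (Submodule.span ℂ {ones N})ᗮ :=
    ⟨H.sub_mem hh (H.smul_mem c h1), Submodule.mem_orthogonal_singleton_iff_inner_right.2 hc⟩
  have e1 : inner ℂ (h - c • ones N) v = 0 := Submodule.inner_right_of_mem_orthogonal hmem hv
  have e2 : inner ℂ (h - c • ones N) (ones N) = 0 := inner_eq_zero_symm.1 hc
  have e3 : inner ℂ (ones N) (v - ((∑ x, v x) / (N : ℂ)) • ones N) = 0 := by
    rw [inner_sub_right, inner_smul_right, h11, div_mul_cancel₀ _ hN0, inner_ones_left, sub_self]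
  rw [← sub_add_cancel h (c • ones N), inner_add_left, inner_smul_left, e3, inner_sub_right,
    inner_smul_right, e1, e2]
  simp

end SmallSubspaces

/-! ### Functions of `ρ_N(p)` in an eigenbasis -/

section Eigenvalues

variable {Γ : Type*} [Group Γ] {N : ℕ}

theorem toEuclideanLin_aeval_apply {A : Matrix (Fin N) (Fin N) ℂ}
    {v : EuclideanSpace ℂ (Fin N)} {c : ℝ} (h : Matrix.toEuclideanLin A v = (c : ℂ) • v)
    (P : Polynomial ℝ) :
    Matrix.toEuclideanLin (Polynomial.aeval A (P.map (algebraMap ℝ ℂ))) v =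
      ((P.eval c : ℝ) : ℂ) • v := by
  rw [Polynomial.aeval_eq_sum_range, map_sum, LinearMap.sum_apply]
  simp only [map_smul, LinearMap.smul_apply, toEuclideanLin_pow_apply h, smul_smul]
  rw [← Finset.sum_smul, ← Polynomial.eval_eq_sum_range]
  congr 1
  exact Polynomial.eval_map_apply (algebraMap ℝ ℂ) c

theorem abs_eigenvalue_le {p : MonoidAlgebra ℂ Γ} {ρ : Γ →* Equiv.Perm (Fin N)}
    {φ : OrthonormalBasis (Fin N) ℂ (EuclideanSpace ℂ (Fin N))} {ev : Fin N → ℝ}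
    (h : IsEigenbasis (permAlg ρ p) φ ev) (α : Fin N) : |ev α| ≤ l1norm p := by
  have := norm_permLift_apply_le ρ p (φ α)
  rw [permLift_apply, h α, norm_smul, φ.norm_eq_one] at this
  simpa using this

theorem permLift_poissonElt_apply {p : MonoidAlgebra ℂ Γ} {ρ : Γ →* Equiv.Perm (Fin N)}
    {φ : OrthonormalBasis (Fin N) ℂ (EuclideanSpace ℂ (Fin N))} {ev : Fin N → ℝ}
    (h : IsEigenbasis (permAlg ρ p) φ ev) (M E η : ℝ) (n : ℕ) (α : Fin N) :
    Matrix.toEuclideanLin (permLift ρ (poissonElt p M E η n)) (φ α) =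
      (((poissonPoly M E η n).eval (ev α) : ℝ) : ℂ) • φ α := by
  rw [poissonElt, ← Polynomial.aeval_algHom_apply, permLift_apply]
  exact toEuclideanLin_aeval_apply (h α) _

/-- `∑_{α,β} c₁(α) c₂(β) |⟨φ_β, K φ_α⟩|² = Tr (K* A₂ K A₁)` if `A₁` and `A₂` are diagonal in the
basis `φ` with eigenvalues `c₁` and `c₂`. -/
theorem trace_conjTranspose_mul_mul_mul {A₁ A₂ : Matrix (Fin N) (Fin N) ℂ}
    {φ : OrthonormalBasis (Fin N) ℂ (EuclideanSpace ℂ (Fin N))} {c₁ c₂ : Fin N → ℝ}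
    (h₁ : ∀ i, Matrix.toEuclideanLin A₁ (φ i) = (c₁ i : ℂ) • φ i)
    (h₂ : ∀ i, Matrix.toEuclideanLin A₂ (φ i) = (c₂ i : ℂ) • φ i)
    (K : Matrix (Fin N) (Fin N) ℂ) :
    (K.conjTranspose * A₂ * K * A₁).trace = ((∑ α, ∑ β, c₁ α * c₂ β *
      ‖inner ℂ (φ β) (Matrix.toEuclideanLin K (φ α))‖ ^ 2 : ℝ) : ℂ) := by
  rw [trace_eq_sum_inner _ φ, Complex.ofReal_sum]
  refine Finset.sum_congr rfl fun α _ => ?_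
  rw [toEuclideanLin_mul_apply, h₁, map_smul, inner_smul_right, toEuclideanLin_mul_apply,
    toEuclideanLin_mul_apply, inner_conjTranspose_apply, inner_apply_eq_sum h₂,
    ← Complex.ofReal_mul, Finset.mul_sum]
  simp only [mul_assoc]

end Eigenvalues

/-! ### Local operators and their centred diagonals -/

section LocalOperators

variable {Γ : Type*} [Group Γ] {N : ℕ}

/-- The local operator `∑_{t ∈ T} ρ(t) D(b_t)`. -/
def localOp (ρ : Γ →* Equiv.Perm (Fin N)) (T : Finset Γ) (b : Γ → Fin N → ℂ) :
    Matrix (Fin N) (Fin N) ℂ :=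
  ∑ t ∈ T, permMat ρ t * Matrix.diagonal (b t)

theorem localOp_apply (ρ : Γ →* Equiv.Perm (Fin N)) (T : Finset Γ) (b : Γ → Fin N → ℂ)
    (x y : Fin N) : localOp ρ T b x y = ∑ t ∈ T, if x = ρ t y then b t y else 0 := by
  rw [localOp, Matrix.sum_apply]
  simp only [Matrix.mul_diagonal, permMat, Matrix.of_apply, ite_mul, one_mul, zero_mul]

theorem average_apply (ρ : Γ →* Equiv.Perm (Fin N)) (T : Finset Γ)
    (K : Matrix (Fin N) (Fin N) ℂ) (x y : Fin N) :
    average ρ T K x y =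
      ∑ t ∈ T, if x = ρ t y then (∑ z, K (ρ t z) z) / (N : ℂ) else 0 := by
  rw [average, Matrix.sum_apply]
  simp only [Matrix.smul_apply, permMat, Matrix.of_apply, smul_eq_mul, mul_ite, mul_one, mul_zero]

/-- The centered diagonals of a local operator, divided by two. -/
def halfCentered (ρ : Γ →* Equiv.Perm (Fin N)) (K : Matrix (Fin N) (Fin N) ℂ) (t : Γ)
    (y : Fin N) : ℂ :=
  1 / 2 * (K (ρ t y) y - (∑ z, K (ρ t z) z) / (N : ℂ))

/-- An entry and a mean are each bounded by 1; halving their difference keeps the normalization that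
the trace estimate asks for. -/
theorem norm_halfCentered_le {ρ : Γ →* Equiv.Perm (Fin N)} {K : Matrix (Fin N) (Fin N) ℂ}
    (hK : ∀ x y, ‖K x y‖ ≤ 1) (t : Γ) (y : Fin N) : ‖halfCentered ρ K t y‖ ≤ 1 := by
  have h1 : ‖(∑ z, K (ρ t z) z) / (N : ℂ)‖ ≤ 1 := by
    rw [norm_div, Complex.norm_natCast]
    refine div_le_one_of_le₀ ((norm_sum_le _ _).trans ?_) (Nat.cast_nonneg _)
    calc _ ≤ ∑ _z : Fin N, (1 : ℝ) := Finset.sum_le_sum fun z _ => hK _ _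
      _ = N := by simp
  have h2 := norm_sub_le (K (ρ t y) y) ((∑ z, K (ρ t z) z) / (N : ℂ))
  have h3 := hK (ρ t y) y
  rw [halfCentered, norm_mul]
  norm_num
  linarith

/-- The difference between a centered local operator and the operator built from its centered
diagonals comes from collisions only. -/
theorem sub_average_sub_localOp_apply [DecidableEq Γ] (ρ : Γ →* Equiv.Perm (Fin N)) (T : Finset Γ)
    (K : Matrix (Fin N) (Fin N) ℂ) (x y : Fin N) :
    (K - average ρ T K - (2 : ℂ) • localOp ρ T (halfCentered ρ K)) x y =
      K x y * (1 - ((T.filter fun t => x = ρ t y).card : ℂ)) := by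
  rw [Matrix.sub_apply, Matrix.sub_apply, Matrix.smul_apply, localOp_apply, average_apply,
    sub_sub, smul_eq_mul, Finset.mul_sum, ← Finset.sum_add_distrib, mul_sub, mul_one,
    Finset.card_eq_sum_ones, Nat.cast_sum, Finset.sum_filter, Finset.mul_sum]
  congr 1
  refine Finset.sum_congr rfl fun t _ => ?_
  split_ifs with h
  · rw [h, halfCentered, Nat.cast_one]; ring
  · simp

/-- Let `m x y` count the `t ∈ T` that carry `y` to `x`. The entry is `K x y * (1 - m x y)`: it
vanishes for `m = 0` by locality and for `m = 1` trivially, so only collision columns remain. In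
such a column `∑ m² ≤ (∑ m)² = |T|²`. -/
theorem sum_norm_sq_sub_average_sub_localOp_le [DecidableEq Γ] {ρ : Γ →* Equiv.Perm (Fin N)}
    {T : Finset Γ} {K : Matrix (Fin N) (Fin N) ℂ} (hloc : IsLocal ρ T K)
    (hK : ∀ x y, ‖K x y‖ ≤ 1) :
    ∑ y, ∑ x, ‖(K - average ρ T K - (2 : ℂ) • localOp ρ T (halfCentered ρ K)) x y‖ ^ 2 ≤
      (T.card : ℝ) ^ 2 * (collisions ρ T).card := by
  set m : Fin N → Fin N → ℕ := fun x y => (T.filter fun t => x = ρ t y).card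
  have hm : ∀ x y, m x y = 0 → K x y = 0 := by
    intro x y h
    refine hloc x y fun ⟨g, hg, hx⟩ => ?_
    exact Finset.notMem_empty g (Finset.card_eq_zero.1 h ▸ Finset.mem_filter.2 ⟨hg, hx⟩)
  have hle : ∀ x y, ‖K x y * (1 - (m x y : ℂ))‖ ≤ m x y := by
    intro x y
    rcases Nat.eq_zero_or_pos (m x y) with h | h
    · rw [hm x y h, zero_mul, norm_zero]; positivity
    · have h1 : (1 : ℝ) ≤ m x y := by exact_mod_cast h
      have h2 : ‖(1 - (m x y : ℂ))‖ = m x y - 1 := by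
        rw [← Complex.ofReal_natCast, ← Complex.ofReal_one, ← Complex.ofReal_sub, Complex.norm_real,
          Real.norm_eq_abs, abs_of_nonpos (by linarith)]
        ring
      rw [norm_mul, h2]
      nlinarith [hK x y, norm_nonneg (K x y)]
  have hsum : ∀ y, ∑ x, (m x y : ℝ) = T.card := by
    intro y
    have := Finset.card_eq_sum_card_fiberwise (s := T) (t := Finset.univ) (f := fun t => ρ t y)
      (fun _ _ => Finset.mem_coe.2 (Finset.mem_univ _))
    rw [this]
    push_cast
    refine Finset.sum_congr rfl fun x _ => ?_
    simp only [m, eq_comm]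
  have hcol : ∀ y, y ∉ collisions ρ T → ∀ x, K x y * (1 - (m x y : ℂ)) = 0 := by
    intro y hy x
    rcases Nat.eq_zero_or_pos (m x y) with h | h
    · rw [hm x y h, zero_mul]
    · have h1 : m x y ≤ 1 := by
        refine Finset.card_le_one.2 fun s hs t ht => ?_
        by_contra hst
        refine hy ?_
        simp only [collisions, Finset.mem_biUnion, Finset.mem_offDiag, Finset.mem_filter,
          Finset.mem_univ, true_and]
        obtain ⟨hs, hs'⟩ := Finset.mem_filter.1 hs
        obtain ⟨ht, ht'⟩ := Finset.mem_filter.1 ht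
        refine ⟨(s, t), ⟨hs, ht, hst⟩, ?_⟩
        simp [← ht', hs']
      have h2 : m x y = 1 := le_antisymm h1 h
      simp [h2]
  simp only [sub_average_sub_localOp_apply]
  calc _ ≤ ∑ y, if y ∈ collisions ρ T then (T.card : ℝ) ^ 2 else 0 := by
        refine Finset.sum_le_sum fun y _ => ?_
        split_ifs with hy
        · rw [← hsum y]
          refine le_trans (Finset.sum_le_sum fun x _ =>
            pow_le_pow_left₀ (norm_nonneg _) (hle x y) 2) ?_
          exact Finset.sum_sq_le_sq_sum_of_nonneg fun x _ => Nat.cast_nonneg _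
        · refine le_of_eq (Finset.sum_eq_zero fun x _ => ?_)
          rw [hcol y hy x]; simp
    _ = _ := by rw [← Finset.sum_filter]; simp [mul_comm]

/-- The Hilbert–Schmidt norm does not depend on the basis; this is the trace formula with both
diagonal operators equal to the identity. -/
theorem sum_norm_sq_inner_eq (φ : OrthonormalBasis (Fin N) ℂ (EuclideanSpace ℂ (Fin N)))
    (Z : Matrix (Fin N) (Fin N) ℂ) :
    ∑ α, ∑ β, ‖inner ℂ (φ β) (Matrix.toEuclideanLin Z (φ α))‖ ^ 2 = ∑ y, ∑ x, ‖Z x y‖ ^ 2 := by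
  have h1 : ∀ i, Matrix.toEuclideanLin (1 : Matrix (Fin N) (Fin N) ℂ) (φ i) =
      ((1 : ℝ) : ℂ) • φ i := fun i => by simp
  have h := trace_conjTranspose_mul_mul_mul (φ := φ) h1 h1 Z
  simp only [mul_one, one_mul] at h
  have h2 : (Z.conjTranspose * Z).trace = ((∑ y, ∑ x, ‖Z x y‖ ^ 2 : ℝ) : ℂ) := by
    rw [Matrix.trace]
    push_cast
    refine Finset.sum_congr rfl fun y _ => ?_
    rw [Matrix.diag_apply, Matrix.mul_apply]
    refine Finset.sum_congr rfl fun x _ => ?_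
    rw [Matrix.conjTranspose_apply]
    exact Complex.conj_mul' _
  rw [h2] at h
  exact (Complex.ofReal_injective h).symm

theorem norm_toLp_le_sqrt {a : Fin N → ℂ} (ha : ∀ x, ‖a x‖ ≤ 1) :
    ‖(WithLp.toLp 2 a : EuclideanSpace ℂ (Fin N))‖ ≤ Real.sqrt N := by
  rw [EuclideanSpace.norm_eq]
  refine Real.sqrt_le_sqrt ?_
  calc _ ≤ ∑ _x : Fin N, (1 : ℝ) := Finset.sum_le_sum fun x _ =>
        pow_le_one₀ (norm_nonneg _) (ha x)
    _ = N := by simp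

end LocalOperators

/-! ### Expansion of `Tr (K* ρ(q₂) K ρ(q₁))` over fixed points -/

section TraceExpansion

variable {Γ : Type*} [Group Γ] {N : ℕ}

/-- The element with coefficients `u_h q_{h⁻¹}`. -/
def hadamard (u q : MonoidAlgebra ℂ Γ) : MonoidAlgebra ℂ Γ :=
  MonoidAlgebra.ofCoeff (Finsupp.onFinset u.coeff.support (fun h => u.coeff h * q.coeff h⁻¹)
    fun h hh => by
      rw [Finsupp.mem_support_iff]
      exact left_ne_zero_of_mul hh)

theorem hadamard_coeff (u q : MonoidAlgebra ℂ Γ) (h : Γ) :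
    (hadamard u q).coeff h = u.coeff h * q.coeff h⁻¹ := rfl

theorem permLift_hadamard (ρ : Γ →* Equiv.Perm (Fin N)) (u q : MonoidAlgebra ℂ Γ) :
    permLift ρ (hadamard u q) =
      ∑ h ∈ u.coeff.support, (u.coeff h * q.coeff h⁻¹) • permMat ρ h := by
  rw [permLift_apply, permAlg]
  refine Finset.sum_subset (fun h hh => ?_) fun h _ hh => ?_
  · rw [Finsupp.mem_support_iff, hadamard_coeff] at hh
    exact Finsupp.mem_support_iff.2 (left_ne_zero_of_mul hh)
  rw [Finsupp.notMem_support_iff.1 hh, zero_smul]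

theorem trace_diagonal_mul_permMat (ρ : Γ →* Equiv.Perm (Fin N)) (a a' : Fin N → ℂ) (h g : Γ) :
    (Matrix.diagonal (star a) * permMat ρ h * Matrix.diagonal a' * permMat ρ g).trace =
      ∑ x, if x = ρ (h * g) x then (starRingEnd ℂ) (a x) * a' (ρ g x) else 0 := by
  rw [Matrix.trace]
  refine Finset.sum_congr rfl fun x _ => ?_
  rw [Matrix.diag_apply, Matrix.mul_apply, Finset.sum_eq_single (ρ g x)]
  · simp [Matrix.mul_diagonal, Matrix.diagonal_mul, permMat]
  · intro y _ hy
    simp [permMat, hy]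
  · simp

theorem norm_trace_diagonal_mul_permMat_le (ρ : Γ →* Equiv.Perm (Fin N)) {a a' : Fin N → ℂ}
    (ha : ∀ x, ‖a x‖ ≤ 1) (ha' : ∀ x, ‖a' x‖ ≤ 1) (h g : Γ) :
    ‖(Matrix.diagonal (star a) * permMat ρ h * Matrix.diagonal a' * permMat ρ g).trace‖ ≤
      ‖(permMat ρ (h * g)).trace‖ := by
  rw [trace_diagonal_mul_permMat, trace_permMat, Complex.norm_natCast, Finset.card_eq_sum_ones,
    Nat.cast_sum, Finset.sum_filter]
  refine (norm_sum_le _ _).trans (Finset.sum_le_sum fun x _ => ?_)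
  split_ifs
  · rw [norm_mul, RCLike.norm_conj, Nat.cast_one]
    exact mul_le_one₀ (ha _) (norm_nonneg _) (ha' _)
  · simp

theorem trace_diagonal_mul_permMat_inv (ρ : Γ →* Equiv.Perm (Fin N)) (a a' : Fin N → ℂ) (h : Γ) :
    (Matrix.diagonal (star a) * permMat ρ h * Matrix.diagonal a' * permMat ρ h⁻¹).trace =
      inner ℂ (WithLp.toLp 2 a) (Matrix.toEuclideanLin (permMat ρ h) (WithLp.toLp 2 a')) := by
  rw [trace_diagonal_mul_permMat, PiLp.inner_apply]
  refine Finset.sum_congr rfl fun x _ => ?_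
  rw [toEuclideanLin_permMat_apply]
  simp [mul_comm]

/-- The number of fixed points that `u` and `q` see, apart from those of the identity. -/
def fixError [DecidableEq Γ] (ρ : Γ →* Equiv.Perm (Fin N)) (u q : MonoidAlgebra ℂ Γ) : ℝ :=
  ∑ h ∈ u.coeff.support, ∑ g ∈ q.coeff.support.erase h⁻¹,
    ‖u.coeff h‖ * ‖q.coeff g‖ * ‖(permMat ρ (h * g)).trace‖

/-- Expand both group algebra elements. The pairs with `g = h⁻¹` add up exactly to the quadratic
form of the Hadamard element; any other pair only sees the fixed points of `h g ≠ e`. -/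
theorem norm_trace_sub_inner_le [DecidableEq Γ] (ρ : Γ →* Equiv.Perm (Fin N)) {a a' : Fin N → ℂ}
    (ha : ∀ x, ‖a x‖ ≤ 1) (ha' : ∀ x, ‖a' x‖ ≤ 1) (u q : MonoidAlgebra ℂ Γ) :
    ‖(Matrix.diagonal (star a) * permLift ρ u * Matrix.diagonal a' * permLift ρ q).trace -
      inner ℂ (WithLp.toLp 2 a)
        (Matrix.toEuclideanLin (permLift ρ (hadamard u q)) (WithLp.toLp 2 a'))‖ ≤
      fixError ρ u q := by
  have h1 : (Matrix.diagonal (star a) * permLift ρ u * Matrix.diagonal a' * permLift ρ q).trace =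
      ∑ h ∈ u.coeff.support, ∑ g ∈ q.coeff.support, u.coeff h * q.coeff g *
        (Matrix.diagonal (star a) * permMat ρ h * Matrix.diagonal a' * permMat ρ g).trace := by
    rw [permLift_apply, permLift_apply, permAlg, permAlg]
    simp only [Finset.mul_sum, Finset.sum_mul, Matrix.trace_sum, mul_smul_comm, smul_mul_assoc,
      Matrix.trace_smul, smul_eq_mul]
    rw [Finset.sum_comm]
    refine Finset.sum_congr rfl fun h _ => Finset.sum_congr rfl fun g _ => ?_
    ring
  have h2 : inner ℂ (WithLp.toLp 2 a)
        (Matrix.toEuclideanLin (permLift ρ (hadamard u q)) (WithLp.toLp 2 a')) =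
      ∑ h ∈ u.coeff.support, u.coeff h * q.coeff h⁻¹ *
        (Matrix.diagonal (star a) * permMat ρ h * Matrix.diagonal a' * permMat ρ h⁻¹).trace := by
    rw [permLift_hadamard]
    simp only [map_sum, LinearMap.sum_apply, map_smul, LinearMap.smul_apply, inner_sum,
      inner_smul_right, trace_diagonal_mul_permMat_inv]
  rw [h1, h2, ← Finset.sum_sub_distrib, fixError]
  refine (norm_sum_le _ _).trans (Finset.sum_le_sum fun h _ => ?_)
  have h3 : ∑ g ∈ q.coeff.support, u.coeff h * q.coeff g *
        (Matrix.diagonal (star a) * permMat ρ h * Matrix.diagonal a' * permMat ρ g).trace -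
      u.coeff h * q.coeff h⁻¹ *
        (Matrix.diagonal (star a) * permMat ρ h * Matrix.diagonal a' * permMat ρ h⁻¹).trace =
      ∑ g ∈ q.coeff.support.erase h⁻¹, u.coeff h * q.coeff g *
        (Matrix.diagonal (star a) * permMat ρ h * Matrix.diagonal a' * permMat ρ g).trace := by
    by_cases hq : h⁻¹ ∈ q.coeff.support
    · rw [← Finset.sum_erase_add _ _ hq, add_sub_cancel_right]
    · rw [Finset.erase_eq_of_notMem hq, Finsupp.notMem_support_iff.1 hq]
      simp
  rw [h3]
  refine (norm_sum_le _ _).trans (Finset.sum_le_sum fun g _ => ?_)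
  rw [norm_mul, norm_mul]
  gcongr
  exact norm_trace_diagonal_mul_permMat_le ρ ha ha' h g

theorem tendsto_fixError [DecidableEq Γ] {N : ℕ → ℕ} {ρ : ∀ n, Γ →* Equiv.Perm (Fin (N n))}
    (hρ : ConvDistr ρ) (u q : MonoidAlgebra ℂ Γ) :
    Tendsto (fun n => fixError (ρ n) u q / (N n : ℝ)) atTop (𝓝 0) := by
  have : Tendsto (fun n => ∑ h ∈ u.coeff.support, ∑ g ∈ q.coeff.support.erase h⁻¹,
      ‖u.coeff h‖ * ‖q.coeff g‖ * ‖(permMat (ρ n) (h * g)).trace / (N n : ℂ)‖) atTop (𝓝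
      (∑ h ∈ u.coeff.support, ∑ g ∈ q.coeff.support.erase h⁻¹,
        ‖u.coeff h‖ * ‖q.coeff g‖ * ‖(0 : ℂ)‖)) := by
    refine tendsto_finsetSum _ fun h _ => tendsto_finsetSum _ fun g hg => ?_
    refine ((hρ (h * g) fun hgh => ?_).norm).const_mul _
    exact (Finset.mem_erase.1 hg).1 (eq_inv_of_mul_eq_one_right hgh)
  simp only [norm_zero, mul_zero, Finset.sum_const_zero] at this
  refine this.congr fun n => ?_
  rw [fixError, Finset.sum_div]
  refine Finset.sum_congr rfl fun h _ => ?_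
  rw [Finset.sum_div]
  refine Finset.sum_congr rfl fun g _ => ?_
  rw [norm_div, Complex.norm_natCast, mul_div_assoc]

/-- The element `t⁻¹ q t'` of the group algebra. -/
def twist (t t' : Γ) (q : MonoidAlgebra ℂ Γ) : MonoidAlgebra ℂ Γ :=
  MonoidAlgebra.single t⁻¹ 1 * q * MonoidAlgebra.single t' 1

theorem twist_coeff (t t' : Γ) (q : MonoidAlgebra ℂ Γ) (h : Γ) :
    (twist t t' q).coeff h = q.coeff (t * h * t'⁻¹) := by
  rw [twist, MonoidAlgebra.coeff_mul_single_apply, MonoidAlgebra.coeff_single_mul_apply]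
  simp [mul_assoc]

/-- The elements of the group algebra that control the trace `Tr (K* ρ(q₂) K ρ(q₁))`. -/
def pairElt (q₁ q₂ : MonoidAlgebra ℂ Γ) (t t' : Γ) : MonoidAlgebra ℂ Γ :=
  hadamard (twist t t' q₂) q₁

theorem trace_localOp_eq (ρ : Γ →* Equiv.Perm (Fin N)) (T : Finset Γ) (b : Γ → Fin N → ℂ)
    (q₁ q₂ : MonoidAlgebra ℂ Γ) :
    ((localOp ρ T b).conjTranspose * permLift ρ q₂ * localOp ρ T b * permLift ρ q₁).trace =
      ∑ t ∈ T, ∑ t' ∈ T, (Matrix.diagonal (star (b t)) *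
        permLift ρ (twist t t' q₂) * Matrix.diagonal (b t') * permLift ρ q₁).trace := by
  have h1 : (localOp ρ T b).conjTranspose =
      ∑ t ∈ T, Matrix.diagonal (star (b t)) * permMat ρ t⁻¹ := by
    rw [localOp, Matrix.conjTranspose_sum]
    simp only [Matrix.conjTranspose_mul, Matrix.diagonal_conjTranspose, conjTranspose_permMat]
  have h2 : ∀ t t', permLift ρ (twist t t' q₂) =
      permMat ρ t⁻¹ * permLift ρ q₂ * permMat ρ t' := fun t t' => by
    rw [twist, map_mul, map_mul, permLift_single, permLift_single, one_smul, one_smul]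
  rw [h1, localOp]
  simp only [Finset.mul_sum, Finset.sum_mul, Matrix.trace_sum, h2]
  rw [Finset.sum_comm]
  simp only [Matrix.mul_assoc]

/-- Cauchy–Schwarz: the vectors have entries at most 1, so each norm is at most `√N`. The bound `hκ`
is asked only on the vectors `b t'`, which is how orthogonality to the exceptional subspace enters.
-/
theorem norm_trace_localOp_le [DecidableEq Γ] {ρ : Γ →* Equiv.Perm (Fin N)} {T : Finset Γ}
    {b : Γ → Fin N → ℂ} (hb : ∀ t x, ‖b t x‖ ≤ 1) {q₁ q₂ : MonoidAlgebra ℂ Γ} {κ : Γ → Γ → ℝ}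
    (hκ : ∀ t ∈ T, ∀ t' ∈ T,
      ‖Matrix.toEuclideanLin (permLift ρ (pairElt q₁ q₂ t t')) (WithLp.toLp 2 (b t'))‖ ≤
        κ t t' * ‖(WithLp.toLp 2 (b t') : EuclideanSpace ℂ (Fin N))‖)
    (hκ0 : ∀ t t', 0 ≤ κ t t') :
    ‖((localOp ρ T b).conjTranspose * permLift ρ q₂ * localOp ρ T b * permLift ρ q₁).trace‖ ≤
      ∑ t ∈ T, ∑ t' ∈ T, (κ t t' * N + fixError ρ (twist t t' q₂) q₁) := by
  rw [trace_localOp_eq]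
  refine (norm_sum_le _ _).trans (Finset.sum_le_sum fun t ht => ?_)
  refine (norm_sum_le _ _).trans (Finset.sum_le_sum fun t' ht' => ?_)
  have h1 := norm_trace_sub_inner_le ρ (hb t) (hb t') (twist t t' q₂) q₁
  refine (norm_le_norm_add_norm_sub' _ _).trans (add_le_add ?_ h1)
  refine (norm_inner_le_norm _ _).trans ?_
  have h2 := hκ t ht t' ht'
  calc _ ≤ Real.sqrt N * (κ t t' * Real.sqrt N) := by
        refine mul_le_mul (norm_toLp_le_sqrt (hb t)) (h2.trans ?_) (norm_nonneg _)
          (Real.sqrt_nonneg _)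
        exact mul_le_mul_of_nonneg_left (norm_toLp_le_sqrt (hb t')) (hκ0 t t')
    _ = κ t t' * N := by
        rw [mul_left_comm, Real.mul_self_sqrt (Nat.cast_nonneg _)]

end TraceExpansion

/-! ### Supports of the approximating elements -/

section Supports

variable {Γ : Type*} [Group Γ]

theorem wordLength_le_of_mem_support_pow {S : Finset Γ}
    (hS : Subgroup.closure (S : Set Γ) = ⊤) {p : MonoidAlgebra ℂ Γ} {L : ℕ}
    (hL : ∀ g ∈ p.coeff.support, wordLength S g ≤ L) (i : ℕ) :
    ∀ g ∈ (p ^ i).coeff.support, wordLength S g ≤ i * L := by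
  classical
  induction i with
  | zero =>
    intro g hg
    rw [pow_zero] at hg
    have := MonoidAlgebra.support_coeff_one_subset hg
    rw [Finset.mem_one] at this
    simp [this, wordLength_one]
  | succ i ih =>
    intro g hg
    rw [pow_succ] at hg
    obtain ⟨x, hx, y, hy, rfl⟩ := Finset.mem_mul.1 (MonoidAlgebra.support_coeff_mul_subset _ _ hg)
    rw [add_mul, one_mul]
    exact (wordLength_mul_le hS x y).trans (add_le_add (ih x hx) (hL y hy))

theorem natDegree_poissonPoly_le (M E η : ℝ) (n : ℕ) :
    (poissonPoly M E η n).natDegree ≤ 2 * n := by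
  refine (Polynomial.natDegree_C_mul_le _ _).trans
    (Polynomial.natDegree_sum_le_of_forall_le _ _ fun k hk => ?_)
  have h : (1 - Polynomial.C (1 / M) * ((Polynomial.X - Polynomial.C E) ^ 2 +
      Polynomial.C (η ^ 2))).natDegree ≤ 2 := by compute_degree
  have := (Polynomial.natDegree_pow_le_of_le k h)
  have := Finset.mem_range.1 hk
  omega

/-- The polynomial has degree at most `2 n`. The radius grows only linearly in `n`, while the
accuracy is exponential in `n`. -/
theorem wordLength_le_of_mem_support_poissonElt {S : Finset Γ}
    (hS : Subgroup.closure (S : Set Γ) = ⊤) {p : MonoidAlgebra ℂ Γ} {L : ℕ}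
    (hL : ∀ g ∈ p.coeff.support, wordLength S g ≤ L) (M E η : ℝ) (n : ℕ) {g : Γ}
    (hg : g ∈ (poissonElt p M E η n).coeff.support) : wordLength S g ≤ 2 * n * L := by
  rw [Finsupp.mem_support_iff, poissonElt, Polynomial.aeval_eq_sum_range, MonoidAlgebra.coeff_sum,
    Finsupp.finsetSum_apply] at hg
  obtain ⟨i, hi, hi0⟩ := Finset.exists_ne_zero_of_sum_ne_zero hg
  have h1 : g ∈ (p ^ i).coeff.support := by
    rw [Finsupp.mem_support_iff]
    rintro h
    rw [MonoidAlgebra.coeff_smul_apply, h, smul_zero] at hi0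
    exact hi0 rfl
  refine (wordLength_le_of_mem_support_pow hS hL i g h1).trans (Nat.mul_le_mul_right _ ?_)
  have h2 := Finset.mem_range_succ_iff.1 hi
  exact h2.trans (Polynomial.natDegree_map_le.trans (natDegree_poissonPoly_le M E η n))

end Supports

/-! ### From weighted `ℓ²` norms of paired elements to weighted `ℓ⁴` sums -/

section Weights

variable {Γ : Type*} [Group Γ]

/-- The weighted quartic sum `∑_g |q_g|⁴ (|g| + 1)^a`. -/
def quartic (S : Finset Γ) (a : ℝ) (q : MonoidAlgebra ℂ Γ) : ℝ :=
  ∑ g ∈ q.coeff.support, ‖q.coeff g‖ ^ 4 * ((wordLength S g : ℝ) + 1) ^ a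

theorem sum_comp_le_quartic (S : Finset Γ) (a : ℝ) (q : MonoidAlgebra ℂ Γ) (F : Finset Γ)
    {f : Γ → Γ} (hf : Function.Injective f) :
    ∑ h ∈ F, ‖q.coeff (f h)‖ ^ 4 * ((wordLength S (f h) : ℝ) + 1) ^ a ≤ quartic S a q := by
  classical
  rw [← Finset.sum_image (f := fun g => ‖q.coeff g‖ ^ 4 * ((wordLength S g : ℝ) + 1) ^ a)
    hf.injOn]
  rw [← Finset.sum_filter_ne_zero, quartic]
  refine Finset.sum_le_sum_of_subset_of_nonneg (fun g hg => ?_) fun _ _ _ => by positivity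
  rw [Finsupp.mem_support_iff]
  intro h
  simp [h] at hg

/-- A coefficient is a product of one from each factor, so its square is at most the sum of their
fourth powers. The translations distort the weight only by a constant: `|h| + 1 ≤ (|t| + |t'| +
1)(|t h t'⁻¹| + 1)`. -/
theorem wnormSq_pairElt_le {S : Finset Γ} (hS : Subgroup.closure (S : Set Γ) = ⊤) {a : ℝ}
    (ha : 0 ≤ a) (q₁ q₂ : MonoidAlgebra ℂ Γ) (t t' : Γ) :
    wnormSq S a (pairElt q₁ q₂ t t') ≤
      quartic S a q₁ + ((wordLength S t + wordLength S t' + 1 : ℕ) : ℝ) ^ a * quartic S a q₂ := by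
  set τ : ℝ := ((wordLength S t + wordLength S t' + 1 : ℕ) : ℝ)
  have hinj : Function.Injective fun h : Γ => t * h * t'⁻¹ := fun x y h => by
    simpa using h
  rw [wnormSq]
  refine le_trans ?_ (add_le_add
    (sum_comp_le_quartic S a q₁ (pairElt q₁ q₂ t t').coeff.support inv_injective)
    (mul_le_mul_of_nonneg_left
      (sum_comp_le_quartic S a q₂ (pairElt q₁ q₂ t t').coeff.support hinj)
      (by positivity : 0 ≤ τ ^ a)))
  rw [Finset.mul_sum, ← Finset.sum_add_distrib]
  refine Finset.sum_le_sum fun h _ => ?_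
  rw [pairElt, hadamard_coeff, twist_coeff, norm_mul, mul_pow]
  set A := ‖q₂.coeff (t * h * t'⁻¹)‖
  set A' := ‖q₁.coeff h⁻¹‖
  have h1 : ((wordLength S h : ℝ) + 1) ^ a ≤ ((wordLength S h⁻¹ : ℝ) + 1) ^ a := by
    refine Real.rpow_le_rpow (by positivity) ?_ ha
    have := wordLength_inv_le hS h⁻¹
    rw [inv_inv] at this
    gcongr
  have h2 : ((wordLength S h : ℝ) + 1) ^ a ≤
      τ ^ a * ((wordLength S (t * h * t'⁻¹) : ℝ) + 1) ^ a := by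
    rw [← Real.mul_rpow (by positivity) (by positivity)]
    refine Real.rpow_le_rpow (by positivity) ?_ ha
    have e : h = t⁻¹ * (t * h * t'⁻¹) * t' := by group
    have h3 := wordLength_mul_le hS (t⁻¹ * (t * h * t'⁻¹)) t'
    have h4 := wordLength_mul_le hS t⁻¹ (t * h * t'⁻¹)
    have h5 := wordLength_inv_le hS t
    rw [← e] at h3
    simp only [τ]
    norm_cast
    nlinarith
  have h3 : A ^ 2 * A' ^ 2 ≤ A' ^ 4 + A ^ 4 := by nlinarith [sq_nonneg (A ^ 2 - A' ^ 2)]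
  calc _ ≤ (A' ^ 4 + A ^ 4) * ((wordLength S h : ℝ) + 1) ^ a := by gcongr
    _ = A' ^ 4 * ((wordLength S h : ℝ) + 1) ^ a + A ^ 4 * ((wordLength S h : ℝ) + 1) ^ a :=
        add_mul _ _ _
    _ ≤ A' ^ 4 * ((wordLength S h⁻¹ : ℝ) + 1) ^ a +
        A ^ 4 * (τ ^ a * ((wordLength S (t * h * t'⁻¹) : ℝ) + 1) ^ a) := by gcongr
    _ = _ := by ring

/-- If `q` is close to `r` in `ℓ²`, with support in a ball, then the quartic sum of `q` is
controlled by that of `r`. -/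
theorem quartic_le {S : Finset Γ} (hS : Subgroup.closure (S : Set Γ) = ⊤) {a : ℝ}
    (ha : 0 ≤ a) {q : MonoidAlgebra ℂ Γ} {r : Γ → ℂ} {R : ℕ} {δ C₀ ε : ℝ}
    (hR : ∀ g ∈ q.coeff.support, wordLength S g ≤ R)
    (hqr : ∑ g ∈ q.coeff.support, ‖q.coeff g - r g‖ ^ 2 ≤ δ ^ 2)
    (hδR : δ ^ 4 * ((R : ℝ) + 1) ^ a ≤ 1) (hr1 : ‖r 1‖ ≤ C₀)
    (hr : ∑ g ∈ q.coeff.support, ‖r g‖ ^ 4 * (wordLength S g : ℝ) ^ a ≤ ε) :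
    quartic S a q ≤ 8 * (C₀ ^ 4 + 2 ^ a * ε + 1) := by
  classical
  have h1 : ∀ g ∈ q.coeff.support, ‖q.coeff g‖ ^ 4 * ((wordLength S g : ℝ) + 1) ^ a ≤
      8 * ((if g = 1 then C₀ ^ 4 else 0) + 2 ^ a * (‖r g‖ ^ 4 * (wordLength S g : ℝ) ^ a) +
        δ ^ 2 * ((R : ℝ) + 1) ^ a * ‖q.coeff g - r g‖ ^ 2) := by
    intro g hg
    have e1 : ‖q.coeff g‖ ^ 4 ≤ 8 * (‖r g‖ ^ 4 + ‖q.coeff g - r g‖ ^ 4) := by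
      have := add_pow_le (norm_nonneg (r g)) (norm_nonneg (q.coeff g - r g)) 4
      have h := norm_add_le (r g) (q.coeff g - r g)
      rw [add_sub_cancel] at h
      calc _ ≤ (‖r g‖ + ‖q.coeff g - r g‖) ^ 4 := by gcongr
        _ ≤ _ := by norm_num at this ⊢; linarith
    -- One square is bounded pointwise by `δ²`; the other is kept for the sum over `g`.
    have e2 : ‖q.coeff g - r g‖ ^ 4 * ((wordLength S g : ℝ) + 1) ^ a ≤
        δ ^ 2 * ((R : ℝ) + 1) ^ a * ‖q.coeff g - r g‖ ^ 2 := by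
      have e3 : ‖q.coeff g - r g‖ ^ 2 ≤ δ ^ 2 :=
        (Finset.single_le_sum (f := fun g => ‖q.coeff g - r g‖ ^ 2)
          (fun _ _ => by positivity) hg).trans hqr
      have e4 : ((wordLength S g : ℝ) + 1) ^ a ≤ ((R : ℝ) + 1) ^ a := by
        have := hR g hg
        gcongr
      calc _ = ‖q.coeff g - r g‖ ^ 2 * ((wordLength S g : ℝ) + 1) ^ a *
            ‖q.coeff g - r g‖ ^ 2 := by ring
        _ ≤ _ := by gcongr
    -- The weight `|g|^a` can vanish at the identity, where `C₀` takes over; elsewhere `|g| ≥ 1`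
    -- gives `|g| + 1 ≤ 2 |g|`.
    have e5 : ‖r g‖ ^ 4 * ((wordLength S g : ℝ) + 1) ^ a ≤
        (if g = 1 then C₀ ^ 4 else 0) + 2 ^ a * (‖r g‖ ^ 4 * (wordLength S g : ℝ) ^ a) := by
      split_ifs with hg1
      · subst hg1
        rw [wordLength_one, Nat.cast_zero, zero_add, Real.one_rpow, mul_one]
        have : ‖r 1‖ ^ 4 ≤ C₀ ^ 4 := by gcongr
        have : 0 ≤ (2 : ℝ) ^ a * (‖r 1‖ ^ 4 * 0 ^ a) := by positivity
        linarith
      · have h1 : (1 : ℝ) ≤ wordLength S g := by exact_mod_cast one_le_wordLength hS hg1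
        have h2 : ((wordLength S g : ℝ) + 1) ^ a ≤ 2 ^ a * (wordLength S g : ℝ) ^ a := by
          rw [← Real.mul_rpow (by norm_num) (by positivity)]
          exact Real.rpow_le_rpow (by positivity) (by linarith) ha
        rw [zero_add]
        calc _ ≤ ‖r g‖ ^ 4 * (2 ^ a * (wordLength S g : ℝ) ^ a) := by gcongr
          _ = _ := by ring
    have e6 : 0 ≤ ((wordLength S g : ℝ) + 1) ^ a := by positivity
    nlinarith
  rw [quartic]
  refine (Finset.sum_le_sum h1).trans ?_
  rw [← Finset.mul_sum, Finset.sum_add_distrib, Finset.sum_add_distrib, ← Finset.mul_sum,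
    ← Finset.mul_sum, Finset.sum_ite_eq']
  have hC : 0 ≤ C₀ ^ 4 := by positivity
  have e1 : (if (1 : Γ) ∈ q.coeff.support then C₀ ^ 4 else 0) ≤ C₀ ^ 4 := by
    split_ifs <;> simp [hC]
  have e2 : δ ^ 2 * ((R : ℝ) + 1) ^ a * ∑ g ∈ q.coeff.support, ‖q.coeff g - r g‖ ^ 2 ≤ 1 := by
    refine le_trans ?_ hδR
    calc _ ≤ δ ^ 2 * ((R : ℝ) + 1) ^ a * δ ^ 2 := by gcongr
      _ = _ := by ring
  gcongr

end Weights

/-! ### Smallness of `η ‖λ(w)‖` for the paired elements -/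

section Resolvent

variable {Γ : Type*} [Group Γ]

theorem imRes_one_one_im (p : MonoidAlgebra ℂ Γ) (E η : ℝ) : (imRes p E η 1 1).im = 0 := by
  rw [imRes]
  set R := resolv (leftRegAlg p) ((E : ℂ) + (η : ℂ) * Complex.I)
  rw [← Complex.conj_eq_iff_im, entry, inner_conj_symm,
    ← ContinuousLinearMap.adjoint_inner_right, adjoint_imOp]

theorem FourthMoment.eventually_le {S : Finset Γ} {p : MonoidAlgebra ℂ Γ} {I₀ : Set ℝ} {a : ℝ}
    (h : FourthMoment S p I₀ a) {ε : ℝ} (hε : 0 < ε) :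
    ∀ᶠ η : ℝ in 𝓝[>] 0, ∀ E ∈ I₀, ∀ F : Finset Γ,
      ∑ g ∈ F, η ^ 2 * ‖imRes p E η 1 g‖ ^ 4 * (wordLength S g : ℝ) ^ a ≤ ε := by
  have := h.eventually_lt_const (u := ENNReal.ofReal ε) (by simpa using hε)
  filter_upwards [this] with η hη E hE F
  have h1 : ∑ g ∈ F, ENNReal.ofReal (η ^ 2 * ‖imRes p E η 1 g‖ ^ 4 * (wordLength S g : ℝ) ^ a) ≤
      ENNReal.ofReal ε :=
    (ENNReal.sum_le_tsum F).trans ((le_iSup₂ (f := fun (E : ℝ) (_ : E ∈ I₀) => ∑' g : Γ,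
      ENNReal.ofReal (η ^ 2 * ‖imRes p E η 1 g‖ ^ 4 * (wordLength S g : ℝ) ^ a)) E hE).trans hη.le)
  rw [← ENNReal.ofReal_sum_of_nonneg fun g _ => by positivity] at h1
  exact (ENNReal.ofReal_le_ofReal_iff hε.le).1 h1

/-- A truncation order at which the Neumann series is exponentially accurate compared with the
radius of its support. -/
theorem exists_truncation {M η : ℝ} (hη : 0 < η) (hM : η ^ 2 ≤ M) (a : ℝ) (L : ℕ) :
    ∃ n : ℕ, (1 - η ^ 2 / M) ^ n ≤ 1 / 2 ∧
      (1 / η * (1 - η ^ 2 / M) ^ n) ^ 4 * (((2 * n * L : ℕ) : ℝ) + 1) ^ a ≤ 1 := by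
  have hM0 : 0 < M := lt_of_lt_of_le (by positivity) hM
  set r := 1 - η ^ 2 / M with hr
  have hr0 : 0 ≤ r := by rw [hr, sub_nonneg, div_le_one hM0]; exact hM
  have hr1 : r < 1 := by
    have : 0 < η ^ 2 / M := by positivity
    linarith
  obtain ⟨m, hm⟩ := exists_nat_ge a
  have h1 : Tendsto (fun n : ℕ => r ^ n) atTop (𝓝 0) :=
    tendsto_pow_atTop_nhds_zero_of_lt_one hr0 hr1
  have h2 : Tendsto (fun n : ℕ => (1 / η) ^ 4 * (2 * L + 1) ^ m * ((n : ℝ) ^ m * (r ^ 4) ^ n))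
      atTop (𝓝 0) := by
    have := (tendsto_pow_const_mul_const_pow_of_abs_lt_one m (r := r ^ 4) (by
      rw [abs_of_nonneg (by positivity)]
      exact pow_lt_one₀ hr0 hr1 (by norm_num))).const_mul ((1 / η) ^ 4 * (2 * L + 1) ^ m)
    simpa using this
  obtain ⟨n, hn1, hn2, hn3⟩ := ((h1.eventually_le_const (u := 1 / 2) (by norm_num)).and
    ((h2.eventually_le_const (u := 1) (by norm_num)).and (eventually_ge_atTop 1))).exists
  refine ⟨n, hn1, le_trans ?_ hn2⟩
  -- Since `n ≥ 1`, the `+ 1` is absorbed in `(2 L + 1) n`, leaving a power of `n` against the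
  -- geometric factor.
  have h3 : (((2 * n * L : ℕ) : ℝ) + 1) ^ a ≤ ((2 * L + 1) * n) ^ m := by
    rw [← Real.rpow_natCast]
    have hn' : (1 : ℝ) ≤ n := by exact_mod_cast hn3
    have hL : (0 : ℝ) ≤ L := Nat.cast_nonneg _
    calc _ ≤ (((2 * n * L : ℕ) : ℝ) + 1) ^ (m : ℝ) :=
          Real.rpow_le_rpow_of_exponent_le (by simp; positivity) hm
      _ ≤ _ := by
        refine Real.rpow_le_rpow (by positivity) ?_ (by positivity)
        push_cast
        nlinarith
  calc _ ≤ (1 / η * r ^ n) ^ 4 * ((2 * L + 1) * n) ^ m := by gcongr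
    _ = _ := by rw [mul_pow, mul_pow, ← pow_mul, ← pow_mul, mul_comm n 4]; ring

/-- Applying the difference of operators to `δ_e` turns operator norm closeness into `ℓ²` closeness
of the coefficients. -/
theorem norm_sub_imRes_sq_le {p : MonoidAlgebra ℂ Γ} (q : MonoidAlgebra ℂ Γ) {E η δ : ℝ}
    (h : ‖leftRegLift Γ q - imOp (resolv (leftRegAlg p) ((E : ℂ) + (η : ℂ) * Complex.I))‖ ≤ δ)
    (F : Finset Γ) :
    ∑ g ∈ F, ‖q.coeff g - (imOp (resolv (leftRegAlg p) ((E : ℂ) + (η : ℂ) * Complex.I))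
      (delta 1) : Γ → ℂ) g‖ ^ 2 ≤ δ ^ 2 := by
  refine le_trans ?_ ((sum_sq_apply_delta_le _ F).trans (pow_le_pow_left₀ (norm_nonneg _) h 2))
  refine le_of_eq (Finset.sum_congr rfl fun g _ => ?_)
  rw [← leftRegLift_delta_one q g]
  rfl

/-- The key consequence of rapid decay and of the fourth moment condition. -/
theorem eventually_norm_pairElt_le {C₁ : ℝ} (hRD : HasRapidDecayWith Γ C₁) {S : Finset Γ}
    (hS : Subgroup.closure (S : Set Γ) = ⊤) {a : ℝ} (ha : 2 * C₁ + 1 < a)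
    {p : MonoidAlgebra ℂ Γ} (hp : ∀ g, p.coeff g⁻¹ = (starRingEnd ℂ) (p.coeff g)) {I₀ : Set ℝ}
    (hAC : CondAC p I₀) (hFM : FourthMoment S p I₀ a) {M : ℝ}
    (hM : ∀ E ∈ I₀, ∀ η : ℝ, 0 < η → η ≤ 1 → ∀ t : ℝ, |t| ≤ l1norm p → (t - E) ^ 2 + η ^ 2 ≤ M)
    {L : ℕ} (hL : ∀ g ∈ p.coeff.support, wordLength S g ≤ L) {d : ℝ → ℕ}
    (hd : ∀ η : ℝ, 0 < η → η ≤ 1 → (1 / η * (1 - η ^ 2 / M) ^ d η) ^ 4 *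
      (((2 * d η * L : ℕ) : ℝ) + 1) ^ a ≤ 1) (T : Finset Γ) {ε : ℝ} (hε : 0 < ε) :
    ∀ᶠ η : ℝ in 𝓝[>] 0, ∀ E₁ ∈ I₀, ∀ E₂ ∈ I₀, ∀ t ∈ T, ∀ t' ∈ T,
      η * ‖leftRegLift Γ (pairElt (poissonElt p M E₁ η (d η)) (poissonElt p M E₂ η (d η)) t t')‖ ≤
        ε := by
  obtain ⟨C, hC, hRD'⟩ := exists_norm_leftRegLift_le_wnorm hRD hS ha
  obtain ⟨C₀, hC₀, hAC⟩ := hAC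
  have ha0 : 0 ≤ a := by linarith [hRD.1]
  obtain ⟨τ, hτ0, hτ⟩ : ∃ τ : ℝ, 0 ≤ τ ∧ ∀ t ∈ T, ∀ t' ∈ T,
      ((wordLength S t + wordLength S t' + 1 : ℕ) : ℝ) ^ a ≤ τ := by
    refine ⟨((T.sup (wordLength S) + T.sup (wordLength S) + 1 : ℕ) : ℝ) ^ a, by positivity,
      fun t ht t' ht' => ?_⟩
    have h1 := Finset.le_sup (f := wordLength S) ht
    have h2 := Finset.le_sup (f := wordLength S) ht'
    gcongr
  -- `C²` comes from rapid decay, `1 + τ` from the two quartic sums of a paired element, and 8 from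
  -- `quartic_le`.
  set B : ℝ := C ^ 2 * (1 + τ) * 8 with hB
  have hB0 : 0 ≤ B := by positivity
  obtain ⟨ε₁, hε₁, hε₁'⟩ : ∃ ε₁ : ℝ, 0 < ε₁ ∧ B * (2 ^ a * ε₁) ≤ ε ^ 2 / 2 := by
    refine ⟨ε ^ 2 / 2 / ((B + 1) * 2 ^ a), by positivity, ?_⟩
    rw [← mul_assoc, mul_div_assoc', div_le_iff₀ (by positivity)]
    have : 0 ≤ (2 : ℝ) ^ a * (ε ^ 2 / 2) := by positivity
    nlinarith
  -- The contributions of the identity and of the truncation stay bounded, so the prefactor `η²`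
  -- alone removes them.
  have hlim : Tendsto (fun η : ℝ => B * (η ^ 2 * (C₀ ^ 4 + 1))) (𝓝[>] 0) (𝓝 0) := by
    have : Tendsto (fun η : ℝ => B * (η ^ 2 * (C₀ ^ 4 + 1))) (𝓝 0)
        (𝓝 (B * (0 ^ 2 * (C₀ ^ 4 + 1)))) := by
      apply Continuous.tendsto; fun_prop
    simp only [ne_eq, OfNat.ofNat_ne_zero, not_false_eq_true, zero_pow, zero_mul, mul_zero] at this
    exact this.mono_left nhdsWithin_le_nhds
  filter_upwards [hFM.eventually_le hε₁, hlim.eventually_le_const (u := ε ^ 2 / 2) (by positivity),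
    Ioc_mem_nhdsGT (zero_lt_one' ℝ)] with η hη1 hη2 hη3 E₁ hE₁ E₂ hE₂ t ht t' ht'
  obtain ⟨hη, hη'⟩ := hη3
  have hη2' : 0 < η ^ 2 := by positivity
  have key : ∀ E ∈ I₀, η ^ 2 * quartic S a (poissonElt p M E η (d η)) ≤
      8 * (η ^ 2 * (C₀ ^ 4 + 1) + 2 ^ a * ε₁) := by
    intro E hE
    set q := poissonElt p M E η (d η)
    have h0 := norm_leftRegLift_poissonElt_sub_le hp hη (hM E hE η hη hη') (d η)
    have h1 := norm_sub_imRes_sq_le (p := p) q h0 q.coeff.support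
    have h2 := quartic_le (C₀ := C₀) (ε := ε₁ / η ^ 2) hS ha0
      (fun g hg => wordLength_le_of_mem_support_poissonElt hS hL M E η (d η) hg) h1 (hd η hη hη')
      -- The entry at the identity is real and positive, so (AC) bounds its modulus by `C₀`.
      (by
        rw [← norm_imRes_one_left, ← Complex.re_add_im (imRes p E η 1 1), imRes_one_one_im,
          Complex.ofReal_zero, zero_mul, add_zero, Complex.norm_real, Real.norm_eq_abs, abs_le]
        have := hAC E hE η hη hη'
        have : 0 < C₀⁻¹ := by positivity
        constructor <;> linarith)
      (by
        rw [le_div_iff₀ hη2', mul_comm, Finset.mul_sum]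
        refine le_trans (le_of_eq ?_) (hη1 E hE q.coeff.support)
        refine Finset.sum_congr rfl fun g _ => ?_
        rw [norm_imRes_one_left, mul_assoc])
    calc _ ≤ η ^ 2 * (8 * (C₀ ^ 4 + 2 ^ a * (ε₁ / η ^ 2) + 1)) := by gcongr
      _ = _ := by field_simp; ring
  set q₁ := poissonElt p M E₁ η (d η)
  set q₂ := poissonElt p M E₂ η (d η)
  refine le_of_sq_le_sq ?_ hε.le
  have hw := wnormSq_pairElt_le hS ha0 q₁ q₂ t t'
  have hw0 : 0 ≤ wnormSq S a (pairElt q₁ q₂ t t') :=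
    Finset.sum_nonneg fun _ _ => by positivity
  have hq2 : 0 ≤ quartic S a q₂ := Finset.sum_nonneg fun _ _ => by positivity
  calc _ ≤ (η * (C * Real.sqrt (wnormSq S a (pairElt q₁ q₂ t t')))) ^ 2 := by
        gcongr
        exact hRD' _
    _ = C ^ 2 * (η ^ 2 * wnormSq S a (pairElt q₁ q₂ t t')) := by
        rw [mul_pow, mul_pow, Real.sq_sqrt hw0]; ring
    _ ≤ C ^ 2 * (η ^ 2 * (quartic S a q₁ + τ * quartic S a q₂)) := by
        gcongr
        exact hw.trans (by have := hτ t ht t' ht'; gcongr)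
    _ = C ^ 2 * (η ^ 2 * quartic S a q₁ + τ * (η ^ 2 * quartic S a q₂)) := by ring
    _ ≤ C ^ 2 * (8 * (η ^ 2 * (C₀ ^ 4 + 1) + 2 ^ a * ε₁) +
          τ * (8 * (η ^ 2 * (C₀ ^ 4 + 1) + 2 ^ a * ε₁))) := by
        have := key E₁ hE₁
        have := key E₂ hE₂
        gcongr
    _ = B * (η ^ 2 * (C₀ ^ 4 + 1)) + B * (2 ^ a * ε₁) := by rw [hB]; ring
    _ ≤ ε ^ 2 := by linarith

end Resolvent

/-! ### Counting eigenvalues in windows -/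

section SpectralMeasure

variable {Γ : Type*} [Group Γ]

/-- Convergence of the Stieltjes transform of the empirical spectral measure. -/
theorem eventually_abs_sum_pker_sub_le {N : ℕ → ℕ} (hN : Tendsto N atTop atTop)
    {ρ : ∀ n, Γ →* Equiv.Perm (Fin (N n))} (hρ : ConvDistr ρ) {p : MonoidAlgebra ℂ Γ}
    (hp : ∀ g, p.coeff g⁻¹ = (starRingEnd ℂ) (p.coeff g)) {M E η : ℝ} (hη : 0 < η)
    (hM : ∀ t : ℝ, |t| ≤ l1norm p → (t - E) ^ 2 + η ^ 2 ≤ M) {δ : ℝ} (hδ : 0 < δ) :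
    ∀ᶠ n in atTop, ∀ (φ : OrthonormalBasis (Fin (N n)) ℂ (EuclideanSpace ℂ (Fin (N n))))
      (ev : Fin (N n) → ℝ), IsEigenbasis (permAlg (ρ n) p) φ ev →
      |∑ α, pker E η (ev α) - N n * (imRes p E η 1 1).re| ≤ δ * N n := by
  have h0 := hM 0 (by simpa using l1norm_nonneg p)
  have hη2 : η ^ 2 ≤ M := by nlinarith [sq_nonneg (0 - E)]
  have hM0 : 0 < M := lt_of_lt_of_le (by positivity) hη2
  -- Thirds of `δ`: truncation for `λ(p)`, convergence of the trace, truncation at the eigenvalues.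
  obtain ⟨m, hm⟩ : ∃ m : ℕ, 1 / η * (1 - η ^ 2 / M) ^ m ≤ δ / 3 := by
    have h1 : Tendsto (fun m : ℕ => 1 / η * (1 - η ^ 2 / M) ^ m) atTop (𝓝 (1 / η * 0)) := by
      refine (tendsto_pow_atTop_nhds_zero_of_lt_one ?_ ?_).const_mul _
      · rw [sub_nonneg, div_le_one hM0]; exact hη2
      · have : 0 < η ^ 2 / M := by positivity
        linarith
    rw [mul_zero] at h1
    exact (h1.eventually_le_const (by positivity)).exists
  set q := poissonElt p M E η m
  have h1 : |(q.coeff 1).re - (imRes p E η 1 1).re| ≤ δ / 3 := by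
    have h2 := (norm_apply_delta_le _ 1).trans
      ((norm_leftRegLift_poissonElt_sub_le hp hη hM m).trans hm)
    rw [imRes, entry_eq, ← leftRegLift_delta_one q 1, ← Complex.sub_re]
    exact (Complex.abs_re_le_norm _).trans h2
  filter_upwards [(tendsto_trace_permLift hN hρ q).eventually
    (Metric.closedBall_mem_nhds _ (by positivity : 0 < δ / 3)),
    hN.eventually_gt_atTop 0] with n hn hNn φ ev hev
  have hNn' : (0 : ℝ) < N n := by exact_mod_cast hNn
  have h3 : (permLift (ρ n) q).trace = ((∑ α, (poissonPoly M E η m).eval (ev α) : ℝ) : ℂ) := by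
    rw [trace_eq_sum_inner _ φ, Complex.ofReal_sum]
    refine Finset.sum_congr rfl fun α _ => ?_
    rw [permLift_poissonElt_apply hev, inner_smul_right, inner_self_eq_norm_sq_to_K,
      φ.norm_eq_one]
    simp
  have h4 : |∑ α, (poissonPoly M E η m).eval (ev α) - N n * (q.coeff 1).re| ≤ δ / 3 * N n := by
    rw [dist_eq_norm] at hn
    have h5 := (Complex.abs_re_le_norm _).trans hn
    rw [Complex.sub_re, h3, ← Complex.ofReal_natCast, ← Complex.ofReal_div, Complex.ofReal_re] at h5
    rw [← mul_le_mul_iff_of_pos_right hNn'] at h5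
    refine le_trans (le_of_eq ?_) h5
    rw [← abs_of_pos hNn', ← abs_mul, abs_of_pos hNn']
    congr 1
    field_simp
  have h6 : |∑ α, pker E η (ev α) - ∑ α, (poissonPoly M E η m).eval (ev α)| ≤ δ / 3 * N n := by
    rw [← Finset.sum_sub_distrib]
    calc _ ≤ ∑ α, |pker E η (ev α) - (poissonPoly M E η m).eval (ev α)| :=
          Finset.abs_sum_le_sum_abs _ _
      _ ≤ ∑ _α : Fin (N n), δ / 3 := Finset.sum_le_sum fun α _ => by
          rw [abs_sub_comm]
          exact (abs_poissonPoly_sub_le hη (hM _ (abs_eigenvalue_le hev α)) m).trans hm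
      _ = _ := by simp [mul_comm]
  rw [abs_le] at h1 h4 h6 ⊢
  constructor <;> nlinarith

/-- Under (AC), an interval `[E - η, E + η]` contains at least `c η N` eigenvalues. -/
theorem exists_le_card_specSet {N : ℕ → ℕ} (hN : Tendsto N atTop atTop)
    {ρ : ∀ n, Γ →* Equiv.Perm (Fin (N n))} (hρ : ConvDistr ρ) {p : MonoidAlgebra ℂ Γ}
    (hp : ∀ g, p.coeff g⁻¹ = (starRingEnd ℂ) (p.coeff g)) {I₀ : Set ℝ} (hAC : CondAC p I₀) {M : ℝ}
    (hM : ∀ E ∈ I₀, ∀ η : ℝ, 0 < η → η ≤ 1 → ∀ t : ℝ, |t| ≤ l1norm p →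
      (t - E) ^ 2 + η ^ 2 ≤ M) :
    ∃ c : ℝ, 0 < c ∧ ∀ E ∈ I₀, ∀ η : ℝ, 0 < η → η ≤ 1 → ∀ᶠ n in atTop,
      ∀ (φ : OrthonormalBasis (Fin (N n)) ℂ (EuclideanSpace ℂ (Fin (N n))))
        (ev : Fin (N n) → ℝ), IsEigenbasis (permAlg (ρ n) p) φ ev →
        c * η * N n ≤ (specSet ev (Set.Icc (E - η) (E + η))).card := by
  obtain ⟨C₀, hC₀, hAC⟩ := hAC
  have hC0 : 0 < C₀ := by linarith
  -- The kernel of width `s = η / A` sums to about `N / C₀` or more, the one of width `η` to about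
  -- `C₀ N` or less. With this `A`, the factor `2 / A` makes the subtracted term half of the main
  -- one. The errors with `δ = 1 / (8 C₀)` take another `3/16` of `N / C₀`, which leaves more than a
  -- quarter.
  set A : ℝ := 4 * C₀ ^ 2 with hA
  have hA4 : 4 ≤ A := by nlinarith
  have hA0 : 0 < A := by linarith
  refine ⟨1 / (A * (4 * C₀)), by positivity, fun E hE η hη hη1 => ?_⟩
  set s := η / A with hs
  have hs0 : 0 < s := by positivity
  have hAs : A * s = η := by rw [hs]; field_simp
  have hs1 : s ≤ 1 := by nlinarith
  set δ : ℝ := 1 / (8 * C₀) with hδ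
  have hδ0 : 0 < δ := by positivity
  filter_upwards [eventually_abs_sum_pker_sub_le hN hρ hp hs0 (hM E hE s hs0 hs1) hδ0,
    eventually_abs_sum_pker_sub_le hN hρ hp hη (hM E hE η hη hη1) hδ0] with n h1 h2 φ ev hev
  have h1 := abs_le.1 (h1 φ ev hev)
  have h2 := abs_le.1 (h2 φ ev hev)
  have h3 : s * (∑ α, pker E s (ev α) - 2 / A * ∑ α, pker E η (ev α)) ≤
      (specSet ev (Set.Icc (E - η) (E + η))).card := by
    rw [specSet, Finset.card_eq_sum_ones, Nat.cast_sum, Finset.sum_filter, Finset.mul_sum,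
      ← Finset.sum_sub_distrib, Finset.mul_sum]
    refine Finset.sum_le_sum fun α _ => ?_
    have := pker_sub_le_indicator (E := E) (t := ev α) hs0 (by linarith : 1 ≤ A)
    rw [hAs] at this
    refine this.trans (le_of_eq ?_)
    have e : |ev α - E| ≤ η ↔ ev α ∈ Set.Icc (E - η) (E + η) := by
      rw [abs_le, Set.mem_Icc]
      constructor <;> rintro ⟨h, h'⟩ <;> constructor <;> linarith
    simp only [e, Nat.cast_one]
  refine le_trans ?_ h3
  have h4 := (hAC E hE s hs0 hs1).1
  have h5 := (hAC E hE η hη hη1).2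
  have hNn : (0 : ℝ) ≤ N n := Nat.cast_nonneg _
  have h6 : N n * C₀⁻¹ - δ * N n ≤ ∑ α, pker E s (ev α) := by
    nlinarith [mul_le_mul_of_nonneg_left h4 hNn]
  have h7 : ∑ α, pker E η (ev α) ≤ N n * C₀ + δ * N n := by
    nlinarith [mul_le_mul_of_nonneg_left h5 hNn]
  have h8 : (2 / A) * ∑ α, pker E η (ev α) ≤ (2 / A) * (N n * C₀ + δ * N n) := by gcongr
  have h9 : (2 / A) * (N n * C₀ + δ * N n) ≤ N n * (1 / (2 * C₀)) + δ / 2 * N n := by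
    have e1 : (2 / A) * (N n * C₀) = N n * (1 / (2 * C₀)) := by rw [hA]; field_simp; norm_num
    have e2 : 2 / A ≤ 1 / 2 := by rw [div_le_div_iff₀ hA0 (by norm_num)]; linarith
    have e3 : (2 / A) * (δ * N n) ≤ 1 / 2 * (δ * N n) := by gcongr
    linarith
  calc 1 / (A * (4 * C₀)) * η * N n = s * (N n * (1 / (4 * C₀))) := by rw [hs]; field_simp
    _ ≤ s * (N n * C₀⁻¹ - δ * N n - (N n * (1 / (2 * C₀)) + δ / 2 * N n)) := by
        refine mul_le_mul_of_nonneg_left ?_ hs0.le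
        have : N n * C₀⁻¹ - δ * N n - (N n * (1 / (2 * C₀)) + δ / 2 * N n) -
            N n * (1 / (4 * C₀)) = N n / (16 * C₀) := by
          rw [hδ]; field_simp; ring
        have : (0 : ℝ) ≤ N n / (16 * C₀) := by positivity
        linarith
    _ ≤ _ := by
        refine mul_le_mul_of_nonneg_left ?_ hs0.le
        linarith

end SpectralMeasure

/-! ### Block estimates over pairs of spectral windows -/

section Mixing

variable {Γ : Type*} [Group Γ]

theorem mem_specSet {N : ℕ} {ev : Fin N → ℝ} {J : Set ℝ} {α : Fin N} :
    α ∈ specSet ev J ↔ ev α ∈ J := by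
  simp [specSet]

/-- Each window indicator is at most `10 η` times the polynomial kernel. The kernel is nonnegative
at every eigenvalue, so both sums extend to the whole basis and become a trace. -/
theorem sum_specSet_norm_inner_le {N : ℕ} {ρ : Γ →* Equiv.Perm (Fin N)} {p : MonoidAlgebra ℂ Γ}
    {φ : OrthonormalBasis (Fin N) ℂ (EuclideanSpace ℂ (Fin N))} {ev : Fin N → ℝ}
    (hev : IsEigenbasis (permAlg ρ p) φ ev) (K : Matrix (Fin N) (Fin N) ℂ) {M E₁ E₂ η : ℝ}
    (hη : 0 < η) (h₁ : ∀ t : ℝ, |t| ≤ l1norm p → (t - E₁) ^ 2 + η ^ 2 ≤ M)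
    (h₂ : ∀ t : ℝ, |t| ≤ l1norm p → (t - E₂) ^ 2 + η ^ 2 ≤ M) {m : ℕ}
    (hm : (1 - η ^ 2 / M) ^ m ≤ 1 / 2) :
    ∑ α ∈ specSet ev (Set.Icc (E₁ - 2 * η) (E₁ + 2 * η)),
      ∑ β ∈ specSet ev (Set.Icc (E₂ - 2 * η) (E₂ + 2 * η)),
        ‖inner ℂ (φ β) (Matrix.toEuclideanLin K (φ α))‖ ^ 2 ≤
      100 * η ^ 2 * ‖(K.conjTranspose * permLift ρ (poissonElt p M E₂ η m) * K *
        permLift ρ (poissonElt p M E₁ η m)).trace‖ := by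
  have hP : ∀ E : ℝ, (∀ t : ℝ, |t| ≤ l1norm p → (t - E) ^ 2 + η ^ 2 ≤ M) → ∀ α,
      0 ≤ (poissonPoly M E η m).eval (ev α) ∧
      (α ∈ specSet ev (Set.Icc (E - 2 * η) (E + 2 * η)) →
        1 ≤ 10 * η * (poissonPoly M E η m).eval (ev α)) := by
    intro E hE α
    have hD := hE _ (abs_eigenvalue_le hev α)
    refine ⟨poissonPoly_nonneg hη hD m, fun hα => one_le_poissonPoly hη hD hm ?_⟩
    rw [mem_specSet, Set.mem_Icc] at hα
    rw [abs_le]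
    constructor <;> linarith
  rw [trace_conjTranspose_mul_mul_mul (permLift_poissonElt_apply hev M E₁ η m)
    (permLift_poissonElt_apply hev M E₂ η m) K, Complex.norm_real, Real.norm_eq_abs]
  refine le_trans ?_ (mul_le_mul_of_nonneg_left (le_abs_self _) (by positivity))
  have h0 : ∀ α β, 0 ≤ 100 * η ^ 2 * ((poissonPoly M E₁ η m).eval (ev α) *
      (poissonPoly M E₂ η m).eval (ev β) *
      ‖inner ℂ (φ β) (Matrix.toEuclideanLin K (φ α))‖ ^ 2) := by
    intro α β
    have := (hP E₁ h₁ α).1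
    have := (hP E₂ h₂ β).1
    positivity
  simp only [Finset.mul_sum]
  calc _ ≤ ∑ α ∈ specSet ev (Set.Icc (E₁ - 2 * η) (E₁ + 2 * η)),
      ∑ β ∈ specSet ev (Set.Icc (E₂ - 2 * η) (E₂ + 2 * η)),
        100 * η ^ 2 * ((poissonPoly M E₁ η m).eval (ev α) * (poissonPoly M E₂ η m).eval (ev β) *
          ‖inner ℂ (φ β) (Matrix.toEuclideanLin K (φ α))‖ ^ 2) := by
        refine Finset.sum_le_sum fun α hα => Finset.sum_le_sum fun β hβ => ?_
        have e := one_le_mul_of_one_le_of_one_le ((hP E₁ h₁ α).2 hα) ((hP E₂ h₂ β).2 hβ)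
        calc _ ≤ _ := le_mul_of_one_le_left (sq_nonneg _) e
          _ = _ := by ring
    _ ≤ ∑ α ∈ specSet ev (Set.Icc (E₁ - 2 * η) (E₁ + 2 * η)), ∑ β,
        100 * η ^ 2 * ((poissonPoly M E₁ η m).eval (ev α) * (poissonPoly M E₂ η m).eval (ev β) *
          ‖inner ℂ (φ β) (Matrix.toEuclideanLin K (φ α))‖ ^ 2) :=
        Finset.sum_le_sum fun α _ => Finset.sum_le_univ_sum_of_nonneg (h0 α)
    _ ≤ _ := Finset.sum_le_univ_sum_of_nonneg fun α => Finset.sum_nonneg fun β _ => h0 α β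

theorem sum_coefSq_nonneg {N : ℕ} (φ : OrthonormalBasis (Fin N) ℂ (EuclideanSpace ℂ (Fin N)))
    (K K' : Matrix (Fin N) (Fin N) ℂ) (A B : Finset (Fin N)) :
    0 ≤ ∑ α ∈ A, ∑ β ∈ B, coefSq φ K K' β α :=
  Finset.sum_nonneg fun _ _ => Finset.sum_nonneg fun _ _ => sq_nonneg _

/-- The energies `i 2^{-k}`. -/
def gridPoint (k : ℕ) (i : ℤ) : ℝ := i * (1 / 2) ^ k

theorem exists_gridPoint (k : ℕ) (E : ℝ) :
    gridPoint k ⌊E * 2 ^ k⌋ ≤ E ∧ E < gridPoint k ⌊E * 2 ^ k⌋ + (1 / 2) ^ k := by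
  have h2 : (0 : ℝ) < (1 / 2) ^ k := by positivity
  have h3 : (2 : ℝ) ^ k * (1 / 2) ^ k = 1 := by rw [← mul_pow]; norm_num
  have h4 := mul_le_mul_of_nonneg_right (Int.floor_le (E * 2 ^ k)) h2.le
  have h5 := mul_lt_mul_of_pos_right (Int.lt_floor_add_one (E * 2 ^ k)) h2
  rw [mul_assoc, h3, mul_one] at h4 h5
  rw [add_mul, one_mul] at h5
  exact ⟨h4, h5⟩

theorem coefSq_le {N : ℕ} {φ : OrthonormalBasis (Fin N) ℂ (EuclideanSpace ℂ (Fin N))}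
    {K K' L Z : Matrix (Fin N) (Fin N) ℂ} (h : K - K' - (2 : ℂ) • L = Z) (β α : Fin N) :
    coefSq φ K K' β α ≤ 8 * ‖inner ℂ (φ β) (Matrix.toEuclideanLin L (φ α))‖ ^ 2 +
      2 * ‖inner ℂ (φ β) (Matrix.toEuclideanLin Z (φ α))‖ ^ 2 := by
  have e : inner ℂ (φ β) (Matrix.toEuclideanLin K (φ α)) -
      inner ℂ (φ β) (Matrix.toEuclideanLin K' (φ α)) =
      2 * inner ℂ (φ β) (Matrix.toEuclideanLin L (φ α)) +
        inner ℂ (φ β) (Matrix.toEuclideanLin Z (φ α)) := by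
    rw [← h]
    simp only [map_sub, map_smul, LinearMap.sub_apply, LinearMap.smul_apply, inner_sub_right,
      inner_smul_right]
    ring
  rw [coefSq, e]
  set x := inner ℂ (φ β) (Matrix.toEuclideanLin L (φ α))
  set z := inner ℂ (φ β) (Matrix.toEuclideanLin Z (φ α))
  have h1 : ‖2 * x + z‖ ≤ 2 * ‖x‖ + ‖z‖ := (norm_add_le _ _).trans (by simp)
  calc _ ≤ (2 * ‖x‖ + ‖z‖) ^ 2 := by gcongr
    _ ≤ _ := by nlinarith [sq_nonneg (2 * ‖x‖ - ‖z‖)]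

/-- Subspaces of dimension `o(N)` such that the matrix elements of local operators that are
orthogonal to them are small on average over pairs of spectral windows. -/
theorem exists_submodule_block {N : ℕ → ℕ} (hN : Tendsto N atTop atTop)
    {ρ : ∀ n, Γ →* Equiv.Perm (Fin (N n))} (hρ : ConvDistr ρ) {C₁ : ℝ}
    (hRD : HasRapidDecayWith Γ C₁) {S : Finset Γ}
    (hS : Subgroup.closure (S : Set Γ) = ⊤) {a : ℝ} (ha : 2 * C₁ + 1 < a)
    {p : MonoidAlgebra ℂ Γ} (hp : ∀ g, p.coeff g⁻¹ = (starRingEnd ℂ) (p.coeff g)) {I₀ : Set ℝ}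
    (hAC : CondAC p I₀) (hFM : FourthMoment S p I₀ a) {M : ℝ} (hM1 : 1 ≤ M)
    (hM : ∀ E ∈ I₀, ∀ η : ℝ, 0 < η → η ≤ 1 → ∀ t : ℝ, |t| ≤ l1norm p → (t - E) ^ 2 + η ^ 2 ≤ M)
    (T : Finset Γ) :
    ∃ H : ∀ n, Submodule ℂ (EuclideanSpace ℂ (Fin (N n))),
      Tendsto (fun n => (Module.finrank ℂ (H n) : ℝ) / (N n : ℝ)) atTop (𝓝 0) ∧
      ∀ ε : ℝ, 0 < ε → ∀ᶠ k : ℕ in atTop, ∀ i j : ℤ, gridPoint k i ∈ I₀ → gridPoint k j ∈ I₀ →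
        ∀ᶠ n in atTop, ∀ (φ : OrthonormalBasis (Fin (N n)) ℂ (EuclideanSpace ℂ (Fin (N n))))
          (ev : Fin (N n) → ℝ), IsEigenbasis (permAlg (ρ n) p) φ ev →
          ∀ K : Matrix (Fin (N n)) (Fin (N n)) ℂ, IsLocal (ρ n) T K → (∀ x y, ‖K x y‖ ≤ 1) →
          (∀ t ∈ T, diagVec (ρ n) K t ∈ (H n)ᗮ) →
          ∑ α ∈ specSet ev
              (Set.Icc (gridPoint k i - 2 * (1 / 2) ^ k) (gridPoint k i + 2 * (1 / 2) ^ k)),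
            ∑ β ∈ specSet ev
              (Set.Icc (gridPoint k j - 2 * (1 / 2) ^ k) (gridPoint k j + 2 * (1 / 2) ^ k)),
              coefSq φ K (average (ρ n) T K) β α ≤ ε * (1 / 2) ^ k * N n := by
  classical
  set L := p.coeff.support.sup (wordLength S)
  have hL : ∀ g ∈ p.coeff.support, wordLength S g ≤ L := fun g hg =>
    Finset.le_sup (f := wordLength S) hg
  have hd : ∀ η : ℝ, ∃ d : ℕ, 0 < η → η ≤ 1 → (1 - η ^ 2 / M) ^ d ≤ 1 / 2 ∧
      (1 / η * (1 - η ^ 2 / M) ^ d) ^ 4 * (((2 * d * L : ℕ) : ℝ) + 1) ^ a ≤ 1 := by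
    intro η
    by_cases h : 0 < η ∧ η ≤ 1
    · obtain ⟨d, hd⟩ := exists_truncation h.1 (show η ^ 2 ≤ M by nlinarith [h.1, h.2]) a L
      exact ⟨d, fun _ _ => hd⟩
    · exact ⟨0, fun h1 h2 => (h ⟨h1, h2⟩).elim⟩
  choose d hd using hd
  -- One paired element for each dyadic scale, pair of grid energies and pair in `T`: a countable
  -- family, so one sequence of subspaces serves them all.
  set w : ℕ × ℤ × ℤ × T × T → MonoidAlgebra ℂ Γ := fun x =>
    pairElt (poissonElt p M (gridPoint x.1 x.2.1) ((1 / 2) ^ x.1) (d ((1 / 2) ^ x.1)))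
      (poissonElt p M (gridPoint x.1 x.2.2.1) ((1 / 2) ^ x.1) (d ((1 / 2) ^ x.1)))
      x.2.2.2.1 x.2.2.2.2 with hw
  -- Any margin above `‖λ(w)‖` would do; the margin 1 costs only `η` once the bound is multiplied by
  -- `η`.
  choose Hw hHw0 hHw using fun x => exists_submodule_permLift hN hρ (w x)
    (lt_add_one ‖leftRegLift Γ (w x)‖)
  obtain ⟨H, hH0, hH⟩ := exists_submodule_diagonal
    (fun o : Option (ℕ × ℤ × ℤ × T × T) => match o with
      | none => fun n => Submodule.span ℂ {ones (N n)}
      | some x => Hw x)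
    (fun o => match o with
      | none => tendsto_finrank_span_ones hN
      | some x => hHw0 x)
  -- The constants are removed so that the averages `k_{N,g}` stay unrestricted. Orthogonality to
  -- the rest already makes the centred diagonals orthogonal to `H n`.
  refine ⟨fun n => H n ⊓ (Submodule.span ℂ {ones (N n)})ᗮ,
    squeeze_zero (fun n => by positivity) (fun n => ?_) hH0, fun ε hε => ?_⟩
  · gcongr
    exact Submodule.finrank_mono inf_le_left
  set τ : ℝ := (T.card : ℝ) ^ 2
  -- Here `800 = 8 · 100`, from `coefSq_le` and the two majorants. The thirds of `ε` pay for `η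
  -- ‖λ(w)‖`, for the terms with an extra factor `η`, and for the collisions.
  obtain ⟨ε₁, hε₁, hε₁'⟩ : ∃ ε₁ : ℝ, 0 < ε₁ ∧ 800 * (τ * ε₁) ≤ ε / 3 := by
    refine ⟨ε / (2400 * (τ + 1)), by positivity, ?_⟩
    rw [← mul_assoc, mul_div_assoc', div_le_iff₀ (by positivity)]
    nlinarith
  have hpow : Tendsto (fun k : ℕ => ((1 : ℝ) / 2) ^ k) atTop (𝓝 0) :=
    tendsto_pow_atTop_nhds_zero_of_lt_one (by norm_num) (by norm_num)
  have hpow' : Tendsto (fun k : ℕ => ((1 : ℝ) / 2) ^ k) atTop (𝓝[>] 0) :=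
    tendsto_nhdsWithin_iff.2 ⟨hpow, Eventually.of_forall fun k => by
      show (0 : ℝ) < _
      positivity⟩
  have hsmall : Tendsto (fun k : ℕ => 800 * ((τ + 1) * ((1 : ℝ) / 2) ^ k)) atTop (𝓝 0) := by
    simpa using (hpow.const_mul (τ + 1)).const_mul 800
  filter_upwards [hpow'.eventually (eventually_norm_pairElt_le hRD hS ha hp hAC hFM hM hL
    (fun η h1 h2 => (hd η h1 h2).2) T hε₁), hsmall.eventually_le_const (div_pos hε three_pos)]
    with k hk1 hk2 i j hi hj
  set η : ℝ := (1 / 2) ^ k with hη_def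
  have hη : 0 < η := by positivity
  have hη1 : η ≤ 1 := pow_le_one₀ (by norm_num) (by norm_num)
  set q₁ := poissonElt p M (gridPoint k i) η (d η)
  set q₂ := poissonElt p M (gridPoint k j) η (d η)
  -- With `k`, `i`, `j` fixed, `q₁` and `q₂` do not depend on `n`, so the fixed point errors are
  -- `o(N)`.
  have herr : Tendsto (fun n => ∑ t ∈ T, ∑ t' ∈ T, fixError (ρ n) (twist t t' q₂) q₁ / (N n : ℝ))
      atTop (𝓝 0) := by
    simpa using tendsto_finsetSum T fun t _ => tendsto_finsetSum T fun t' _ =>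
      tendsto_fixError hρ (twist t t' q₂) q₁
  have hcoll : Tendsto (fun n => 2 * (τ * (((collisions (ρ n) T).card : ℝ) / (N n : ℝ)))) atTop
      (𝓝 0) := by
    simpa using ((tendsto_card_collisions hρ T).const_mul τ).const_mul 2
  filter_upwards [hH none,
    (eventually_all.2 fun t : T => eventually_all.2 fun t' : T => hH (some (k, i, j, t, t'))),
    herr.eventually_le_const zero_lt_one, hN.eventually_gt_atTop 0,
    hcoll.eventually_le_const (u := ε / 3 * η) (by positivity)]
    with n hn1 hn3 hn4 hn5 hn6 φ ev hev K hK hKb hKH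
  have hNn : (0 : ℝ) < N n := by exact_mod_cast hn5
  set b := halfCentered (ρ n) K with hb_def
  have hbH : ∀ t ∈ T, (WithLp.toLp 2 (b t) : EuclideanSpace ℂ (Fin (N n))) ∈ (H n)ᗮ := by
    intro t ht
    have := (H n)ᗮ.smul_mem (1 / 2 : ℂ)
      (sub_mean_mem_orthogonal hn5 (hn1 (Submodule.mem_span_singleton_self _)) (hKH t ht))
    convert this using 1
    ext x
    simp [b, halfCentered, diagVec, ones]
  set κ : Γ → Γ → ℝ := fun t t' => ‖leftRegLift Γ (pairElt q₁ q₂ t t')‖ + 1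
  have htr := norm_trace_localOp_le (norm_halfCentered_le hKb) (q₁ := q₁) (q₂ := q₂) (κ := κ)
    (fun t ht t' ht' => hHw (k, i, j, ⟨t, ht⟩, ⟨t', ht'⟩) n _
      (Submodule.orthogonal_le (hn3 ⟨t, ht⟩ ⟨t', ht'⟩) (hbH t' ht')))
    (fun t t' => by positivity)
  have hblock := sum_specSet_norm_inner_le hev (localOp (ρ n) T b) hη (hM _ hi η hη hη1)
    (hM _ hj η hη hη1) (hd η hη hη1).1
  set J₁ := specSet ev (Set.Icc (gridPoint k i - 2 * η) (gridPoint k i + 2 * η))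
  set J₂ := specSet ev (Set.Icc (gridPoint k j - 2 * η) (gridPoint k j + 2 * η))
  have e2 : η * ∑ t ∈ T, ∑ t' ∈ T, κ t t' ≤ τ * (ε₁ + η) := by
    rw [Finset.mul_sum]
    simp only [Finset.mul_sum]
    calc _ ≤ ∑ t ∈ T, ∑ t' ∈ T, (ε₁ + η) := by
          refine Finset.sum_le_sum fun t ht => Finset.sum_le_sum fun t' ht' => ?_
          have := hk1 _ hi _ hj t ht t' ht'
          simp only [κ, mul_add, mul_one]
          linarith
      _ = _ := by simp [τ]; ring
  have e3 : ∑ t ∈ T, ∑ t' ∈ T, fixError (ρ n) (twist t t' q₂) q₁ ≤ N n := by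
    have e : ∑ t ∈ T, ∑ t' ∈ T, fixError (ρ n) (twist t t' q₂) q₁ / (N n : ℝ) =
        (∑ t ∈ T, ∑ t' ∈ T, fixError (ρ n) (twist t t' q₂) q₁) / N n := by
      simp only [Finset.sum_div]
    rw [e, div_le_one hNn] at hn4
    exact hn4
  have e4 : ∑ t ∈ T, ∑ t' ∈ T, (κ t t' * N n + fixError (ρ n) (twist t t' q₂) q₁) ≤
      (∑ t ∈ T, ∑ t' ∈ T, κ t t' + 1) * N n := by
    simp only [Finset.sum_add_distrib, add_mul, one_mul, Finset.sum_mul]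
    gcongr
  have hmain : 8 * ∑ α ∈ J₁, ∑ β ∈ J₂,
      ‖inner ℂ (φ β) (Matrix.toEuclideanLin (localOp (ρ n) T b) (φ α))‖ ^ 2 ≤
      (2 * (ε / 3)) * η * N n :=
    calc _ ≤ 8 * (100 * η ^ 2 * ((∑ t ∈ T, ∑ t' ∈ T, κ t t' + 1) * N n)) := by
          gcongr
          refine hblock.trans ?_
          gcongr
          exact htr.trans e4
      _ = 800 * (η * ∑ t ∈ T, ∑ t' ∈ T, κ t t' + η) * η * N n := by ring
      _ ≤ 800 * (τ * (ε₁ + η) + η) * η * N n := by gcongr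
      _ = (800 * (τ * ε₁) + 800 * ((τ + 1) * η)) * η * N n := by ring
      _ ≤ (2 * (ε / 3)) * η * N n := by
          gcongr
          linarith
  set Z := K - average (ρ n) T K - (2 : ℂ) • localOp (ρ n) T b with hZ
  have hrest : 2 * ∑ α ∈ J₁, ∑ β ∈ J₂, ‖inner ℂ (φ β) (Matrix.toEuclideanLin Z (φ α))‖ ^ 2 ≤
      ε / 3 * η * N n := by
    have h1 : ∑ α ∈ J₁, ∑ β ∈ J₂, ‖inner ℂ (φ β) (Matrix.toEuclideanLin Z (φ α))‖ ^ 2 ≤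
        τ * (collisions (ρ n) T).card := by
      refine le_trans ?_ (sum_norm_sq_sub_average_sub_localOp_le hK hKb)
      rw [← sum_norm_sq_inner_eq φ]
      refine (Finset.sum_le_univ_sum_of_nonneg fun α =>
        Finset.sum_nonneg fun β _ => by positivity).trans ?_
      exact Finset.sum_le_sum fun α _ => Finset.sum_le_univ_sum_of_nonneg fun β => by positivity
    rw [← mul_le_mul_iff_of_pos_right hNn] at hn6
    refine le_trans ?_ hn6
    calc _ ≤ 2 * (τ * (collisions (ρ n) T).card) := by gcongr
      _ = _ := by field_simp
  calc _ ≤ ∑ α ∈ J₁, ∑ β ∈ J₂,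
        (8 * ‖inner ℂ (φ β) (Matrix.toEuclideanLin (localOp (ρ n) T b) (φ α))‖ ^ 2 +
          2 * ‖inner ℂ (φ β) (Matrix.toEuclideanLin Z (φ α))‖ ^ 2) :=
        Finset.sum_le_sum fun α _ => Finset.sum_le_sum fun β _ => coefSq_le hZ.symm β α
    _ = 8 * ∑ α ∈ J₁, ∑ β ∈ J₂,
          ‖inner ℂ (φ β) (Matrix.toEuclideanLin (localOp (ρ n) T b) (φ α))‖ ^ 2 +
        2 * ∑ α ∈ J₁, ∑ β ∈ J₂, ‖inner ℂ (φ β) (Matrix.toEuclideanLin Z (φ α))‖ ^ 2 := by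
        simp only [Finset.sum_add_distrib, Finset.mul_sum]
    _ ≤ ε * η * N n := by linarith

end Mixing

/-! ### From block estimates to ergodicity and mixing -/

section Conclusion

variable {N : ℕ → ℕ}

/-- A window of the type `[E - η, E + η]` is contained in a window around a grid point. -/
theorem Icc_subset_gridWindow {k : ℕ} {E η : ℝ} (hη : η ≤ (1 / 2) ^ k) :
    Set.Icc (E - η) (E + η) ⊆
      Set.Icc (gridPoint k ⌊E * 2 ^ k⌋ - 2 * (1 / 2) ^ k)
        (gridPoint k ⌊E * 2 ^ k⌋ + 2 * (1 / 2) ^ k) := by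
  have := exists_gridPoint k E
  rintro t ⟨h1, h2⟩
  constructor <;> linarith

theorem specSet_mono {n : ℕ} (ev : Fin n → ℝ) {J J' : Set ℝ} (h : J ⊆ J') :
    specSet ev J ⊆ specSet ev J' := fun α hα => by
  rw [mem_specSet] at hα ⊢
  exact h hα

theorem sum_coefSq_mono {n : ℕ} (φ : OrthonormalBasis (Fin n) ℂ (EuclideanSpace ℂ (Fin n)))
    (K K' : Matrix (Fin n) (Fin n) ℂ) {A A' B B' : Finset (Fin n)} (hA : A ⊆ A') (hB : B ⊆ B') :
    ∑ α ∈ A, ∑ β ∈ B, coefSq φ K K' β α ≤ ∑ α ∈ A', ∑ β ∈ B', coefSq φ K K' β α :=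
  (Finset.sum_le_sum fun _ _ => Finset.sum_le_sum_of_subset_of_nonneg hB
    fun _ _ _ => sq_nonneg _).trans (Finset.sum_le_sum_of_subset_of_nonneg hA
    fun _ _ _ => Finset.sum_nonneg fun _ _ => sq_nonneg _)

/-- The diagonal sum over an interval is bounded by the sum of the blocks of a covering. -/
theorem sum_diag_coefSq_le {n : ℕ}
    (φ : OrthonormalBasis (Fin n) ℂ (EuclideanSpace ℂ (Fin n))) (ev : Fin n → ℝ)
    (K K' : Matrix (Fin n) (Fin n) ℂ) {I : Set ℝ} {ι : Type*} {G : Finset ι} {J : ι → Set ℝ}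
    (hcov : ∀ t ∈ I, ∃ i ∈ G, t ∈ J i) :
    ∑ α ∈ specSet ev I, coefSq φ K K' α α ≤
      ∑ i ∈ G, ∑ α ∈ specSet ev (J i), ∑ β ∈ specSet ev (J i), coefSq φ K K' β α := by
  classical
  calc _ ≤ ∑ i ∈ G, ∑ α ∈ specSet ev (J i), coefSq φ K K' α α := by
        simp only [specSet, Finset.sum_filter]
        rw [Finset.sum_comm]
        refine Finset.sum_le_sum fun α _ => ?_
        have hnn : ∀ i ∈ G, 0 ≤ if ev α ∈ J i then coefSq φ K K' α α else 0 := fun i _ => by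
          split_ifs
          exacts [sq_nonneg _, le_rfl]
        split_ifs with h
        · obtain ⟨i, hi, hα⟩ := hcov _ h
          refine le_trans (le_of_eq ?_) (Finset.single_le_sum hnn hi)
          rw [if_pos hα]
        · exact Finset.sum_nonneg hnn
    _ ≤ _ := Finset.sum_le_sum fun i _ => Finset.sum_le_sum fun α hα =>
        Finset.single_le_sum (f := fun β => coefSq φ K K' β α) (fun _ _ => sq_nonneg _) hα

theorem inv_card_mul_le {x c s b : ℝ} {m : ℕ} (hb : 0 < b) (hm : c * b ≤ m) (hc : 0 < c)
    (hs : s ≤ x * b) (hs0 : 0 ≤ s) : (m : ℝ)⁻¹ * s ≤ x / c := by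
  have h1 : 0 < c * b := by positivity
  have hm0 : (0 : ℝ) < m := h1.trans_le hm
  have hx : 0 ≤ x := nonneg_of_mul_nonneg_left (hs0.trans hs) hb
  rw [inv_mul_eq_div, div_le_div_iff₀ hm0 hc]
  calc s * c ≤ x * b * c := by gcongr
    _ = x * (c * b) := by ring
    _ ≤ x * m := by gcongr

variable {φ : ∀ n, OrthonormalBasis (Fin (N n)) ℂ (EuclideanSpace ℂ (Fin (N n)))}
  {ev : ∀ n, Fin (N n) → ℝ} {K Kav : ∀ n, Matrix (Fin (N n)) (Fin (N n)) ℂ}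

/-- About `(b - a) 2^k` grid windows cover the interval, each with a block sum at most `ε' 2^{-k}
N`, so the diagonal sum is `O(ε') N`; the interval itself holds at least `c s N` eigenvalues. One
fixed large `k` is enough. -/
theorem quantumErgodic_of_block (hN : Tendsto N atTop atTop) {a₀ b₀ a b c : ℝ} (ha : a₀ < a)
    (hab : a < b) (hb : b < b₀) (hc : 0 < c)
    (hcard : ∀ E ∈ Set.Icc a₀ b₀, ∀ η : ℝ, 0 < η → η ≤ 1 → ∀ᶠ n in atTop,
      c * η * N n ≤ (specSet (ev n) (Set.Icc (E - η) (E + η))).card)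
    (hblock : ∀ ε : ℝ, 0 < ε → ∀ᶠ k : ℕ in atTop, ∀ i j : ℤ, gridPoint k i ∈ Set.Icc a₀ b₀ →
      gridPoint k j ∈ Set.Icc a₀ b₀ → ∀ᶠ n in atTop,
        ∑ α ∈ specSet (ev n)
            (Set.Icc (gridPoint k i - 2 * (1 / 2) ^ k) (gridPoint k i + 2 * (1 / 2) ^ k)),
          ∑ β ∈ specSet (ev n)
            (Set.Icc (gridPoint k j - 2 * (1 / 2) ^ k) (gridPoint k j + 2 * (1 / 2) ^ k)),
            coefSq (φ n) (K n) (Kav n) β α ≤ ε * (1 / 2) ^ k * N n) :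
    QuantumErgodic φ ev K Kav (Set.Icc a b) := by
  obtain ⟨s, hs0, hs1, hs2⟩ : ∃ s : ℝ, 0 < s ∧ s ≤ 1 ∧ s ≤ (b - a) / 2 :=
    ⟨min 1 ((b - a) / 2), lt_min one_pos (by linarith), min_le_left _ _, min_le_right _ _⟩
  have hcard' : ∀ᶠ n in atTop, c * s * N n ≤ (specSet (ev n) (Set.Icc a b)).card := by
    filter_upwards [hcard ((a + b) / 2) ⟨by linarith, by linarith⟩ s hs0 hs1] with n hn
    refine hn.trans ?_
    have := Finset.card_le_card (specSet_mono (ev n)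
      (Set.Icc_subset_Icc (by linarith : a ≤ (a + b) / 2 - s) (by linarith : (a + b) / 2 + s ≤ b)))
    exact_mod_cast this
  rw [QuantumErgodic, Metric.tendsto_atTop']
  intro ε hε
  set D : ℝ := b - a + 2 with hD
  have hD0 : 0 < D := by linarith
  have hε' : 0 < ε * (c * s) / (2 * D) := by positivity
  have hpow : Tendsto (fun k : ℕ => ((1 : ℝ) / 2) ^ k) atTop (𝓝 0) :=
    tendsto_pow_atTop_nhds_zero_of_lt_one (by norm_num) (by norm_num)
  -- Grid points round energies down, so only the left end needs room: `2^{-k} ≤ a - a₀`.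
  obtain ⟨k, hk1, hk2⟩ := ((hblock _ hε').and
    (hpow.eventually_le_const (u := a - a₀) (by linarith))).exists
  set G : Finset ℤ := Finset.Icc ⌊a * 2 ^ k⌋ ⌊b * 2 ^ k⌋ with hG
  have h2 : (0 : ℝ) < (1 / 2) ^ k := by positivity
  have h3 : (2 : ℝ) ^ k * (1 / 2) ^ k = 1 := by rw [← mul_pow]; norm_num
  have hGmem : ∀ i ∈ G, gridPoint k i ∈ Set.Icc a₀ b₀ := by
    intro i hi
    obtain ⟨hi1, hi2⟩ := Finset.mem_Icc.1 hi
    have e1 : gridPoint k ⌊a * 2 ^ k⌋ ≤ gridPoint k i := by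
      unfold gridPoint; gcongr
    have e2 : gridPoint k i ≤ gridPoint k ⌊b * 2 ^ k⌋ := by
      unfold gridPoint; gcongr
    have := exists_gridPoint k a
    have := exists_gridPoint k b
    constructor <;> linarith
  have hGcard : (G.card : ℝ) * (1 / 2) ^ k ≤ D := by
    have e1 : (G.card : ℝ) ≤ (b - a) * 2 ^ k + 2 := by
      have hle : ⌊a * 2 ^ k⌋ ≤ ⌊b * 2 ^ k⌋ + 1 :=
        (Int.floor_mono (by gcongr : a * 2 ^ k ≤ b * 2 ^ k)).trans (Int.le_add_one le_rfl)
      have : (G.card : ℤ) = ⌊b * 2 ^ k⌋ + 1 - ⌊a * 2 ^ k⌋ := by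
        rw [hG, Int.card_Icc_of_le _ _ hle]
      have e : (G.card : ℝ) = (⌊b * 2 ^ k⌋ : ℝ) + 1 - ⌊a * 2 ^ k⌋ := by exact_mod_cast this
      rw [e]
      have := Int.floor_le (b * 2 ^ k)
      have := Int.lt_floor_add_one (a * 2 ^ k)
      linarith
    have e2 : ((1 : ℝ) / 2) ^ k ≤ 1 := pow_le_one₀ (by norm_num) (by norm_num)
    calc _ ≤ ((b - a) * 2 ^ k + 2) * (1 / 2) ^ k := by gcongr
      _ = (b - a) * (2 ^ k * (1 / 2) ^ k) + 2 * (1 / 2) ^ k := by ring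
      _ ≤ D := by rw [h3]; linarith
  have hev : ∀ᶠ n in atTop, ∀ i ∈ G, _ := (Finset.eventually_all G).2 fun i hi =>
    hk1 i i (hGmem i hi) (hGmem i hi)
  obtain ⟨n₀, hn₀⟩ := eventually_atTop.1 (hev.and (hcard'.and (hN.eventually_gt_atTop 0)))
  refine ⟨n₀, fun n hn => ?_⟩
  obtain ⟨hn1, hn2, hn3⟩ := hn₀ n hn.le
  have hNn : (0 : ℝ) < N n := by exact_mod_cast hn3
  have hnn : 0 ≤ ∑ α ∈ specSet (ev n) (Set.Icc a b), coefSq (φ n) (K n) (Kav n) α α :=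
    Finset.sum_nonneg fun _ _ => sq_nonneg _
  rw [Real.dist_eq, sub_zero, abs_of_nonneg (by positivity)]
  have hsum : ∑ α ∈ specSet (ev n) (Set.Icc a b), coefSq (φ n) (K n) (Kav n) α α ≤
      (ε * (c * s) / 2) * N n := by
    refine (sum_diag_coefSq_le (φ n) (ev n) (K n) (Kav n) (G := G) (J := fun i =>
      Set.Icc (gridPoint k i - 2 * (1 / 2) ^ k) (gridPoint k i + 2 * (1 / 2) ^ k)) ?_).trans ?_
    · intro t ht
      refine ⟨⌊t * 2 ^ k⌋, Finset.mem_Icc.2 ⟨?_, ?_⟩, ?_⟩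
      · exact Int.floor_mono (by have := ht.1; gcongr)
      · exact Int.floor_mono (by have := ht.2; gcongr)
      -- A point is the window of half-width 0 around itself.
      · exact Icc_subset_gridWindow (η := 0) h2.le ⟨by linarith, by linarith⟩
    · refine (Finset.sum_le_sum hn1).trans ?_
      rw [Finset.sum_const, nsmul_eq_mul]
      calc _ = ((G.card : ℝ) * (1 / 2) ^ k) * (ε * (c * s) / (2 * D)) * N n := by ring
        _ ≤ D * (ε * (c * s) / (2 * D)) * N n := by gcongr
        _ = _ := by field_simp
  have hcs : 0 < c * s := by positivity
  calc _ ≤ ε * (c * s) / 2 / (c * s) := inv_card_mul_le hNn hn2 hcs hsum hnn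
    _ = ε / 2 := by field_simp
    _ < ε := by linarith

/-- Choose `k` with `2^{-(k+1)} < η ≤ 2^{-k}`. The windows then lie in grid windows, whose block sum
is at most `(ε c / 2) 2^{-k} N ≤ ε c η N`, while the first window holds at least `c η N`
eigenvalues. -/
theorem quantumMixing_of_block (hN : Tendsto N atTop atTop) {a₀ b₀ a b c : ℝ} (ha : a₀ < a)
    (hb : b < b₀) (hc : 0 < c)
    (hcard : ∀ E ∈ Set.Icc a₀ b₀, ∀ η : ℝ, 0 < η → η ≤ 1 → ∀ᶠ n in atTop,
      c * η * N n ≤ (specSet (ev n) (Set.Icc (E - η) (E + η))).card)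
    (hblock : ∀ ε : ℝ, 0 < ε → ∀ᶠ k : ℕ in atTop, ∀ i j : ℤ, gridPoint k i ∈ Set.Icc a₀ b₀ →
      gridPoint k j ∈ Set.Icc a₀ b₀ → ∀ᶠ n in atTop,
        ∑ α ∈ specSet (ev n)
            (Set.Icc (gridPoint k i - 2 * (1 / 2) ^ k) (gridPoint k i + 2 * (1 / 2) ^ k)),
          ∑ β ∈ specSet (ev n)
            (Set.Icc (gridPoint k j - 2 * (1 / 2) ^ k) (gridPoint k j + 2 * (1 / 2) ^ k)),
            coefSq (φ n) (K n) (Kav n) β α ≤ ε * (1 / 2) ^ k * N n) :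
    QuantumMixing φ ev K Kav (Set.Icc a b) := by
  intro E₁ hE₁ E₂ hE₂
  replace hE₁ := interior_subset hE₁
  replace hE₂ := interior_subset hE₂
  rw [ENNReal.tendsto_nhds_zero]
  intro ε' hε'
  obtain ⟨ε, hε0, hε⟩ : ∃ ε : ℝ, 0 < ε ∧ ENNReal.ofReal ε ≤ ε' := by
    obtain ⟨ε, h1, h2⟩ := ENNReal.lt_iff_exists_real_btwn.1 hε'
    exact ⟨ε, by simpa using h2.1, h2.2.le⟩
  have hpow : Tendsto (fun k : ℕ => ((1 : ℝ) / 2) ^ k) atTop (𝓝 0) :=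
    tendsto_pow_atTop_nhds_zero_of_lt_one (by norm_num) (by norm_num)
  obtain ⟨k₀, hk₀⟩ := eventually_atTop.1 ((hblock (ε * c / 2) (by positivity)).and
    (hpow.eventually_le_const (u := a - a₀) (by linarith)))
  filter_upwards [Ioc_mem_nhdsGT (show (0 : ℝ) < (1 / 2) ^ k₀ by positivity)] with η hη
  obtain ⟨hη0, hηk⟩ := hη
  have hη1 : η ≤ 1 := hηk.trans (pow_le_one₀ (by norm_num) (by norm_num))
  obtain ⟨k, hk1, hk2⟩ := exists_nat_pow_near_of_lt_one hη0 hη1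
    (by norm_num : (0 : ℝ) < 1 / 2) (by norm_num)
  have hkk : k₀ ≤ k := by
    have h1 : ((1 : ℝ) / 2) ^ (k + 1) < (1 / 2) ^ k₀ := hk1.trans_le hηk
    have := (pow_lt_pow_iff_right_of_lt_one₀ (by norm_num : (0 : ℝ) < 1 / 2) (by norm_num)).1 h1
    omega
  obtain ⟨h1, h2⟩ := hk₀ k hkk
  have hmem : ∀ E ∈ Set.Icc a b, gridPoint k ⌊E * 2 ^ k⌋ ∈ Set.Icc a₀ b₀ := by
    intro E hE
    have := exists_gridPoint k E
    have h3 := hE.1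
    have h4 := hE.2
    constructor <;> linarith
  have hE₁' : E₁ ∈ Set.Icc a₀ b₀ := ⟨ha.le.trans hE₁.1, hE₁.2.trans hb.le⟩
  refine le_trans (limsup_le_of_le (by isBoundedDefault) ?_) hε
  filter_upwards [h1 _ _ (hmem E₁ hE₁) (hmem E₂ hE₂), hcard E₁ hE₁' η hη0 hη1,
    hN.eventually_gt_atTop 0] with n hn1 hn2 hn3
  have hNn : (0 : ℝ) < N n := by exact_mod_cast hn3
  refine ENNReal.ofReal_le_ofReal ?_
  have hsum := (sum_coefSq_mono (φ n) (K n) (Kav n)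
    (specSet_mono (ev n) (Icc_subset_gridWindow (E := E₁) hk2))
    (specSet_mono (ev n) (Icc_subset_gridWindow (E := E₂) hk2))).trans hn1
  have hsum' := hsum.trans (show ε * c / 2 * (1 / 2) ^ k * N n ≤ ε * c * (η * N n) by
    rw [pow_succ] at hk1
    have : 0 ≤ ε * c * N n := by positivity
    nlinarith)
  rw [mul_assoc] at hn2
  refine (inv_card_mul_le (by positivity) hn2 hc hsum' (sum_coefSq_nonneg _ _ _ _ _)).trans ?_
  rw [mul_div_cancel_right₀ _ hc.ne']

end Conclusion

end QMix

end

theorem theoremt {Γ : Type*} [Group Γ]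
    -- permutation representations of degrees `N n → ∞`, converging in distribution
    (N : ℕ → ℕ) (hN : Tendsto N atTop atTop)
    (ρ : ∀ n, Γ →* Equiv.Perm (Fin (N n))) (hρ : QMix.ConvDistr ρ)
    -- rapid decay with exponent `C₁`
    (C₁ : ℝ) (hRD : QMix.HasRapidDecayWith Γ C₁)
    -- the finite generating set that defines the word length
    (S : Finset Γ) (hS : Subgroup.closure (S : Set Γ) = ⊤)
    -- `p = p*`
    (p : MonoidAlgebra ℂ Γ) (hp : ∀ g, p.coeff g⁻¹ = (starRingEnd ℂ) (p.coeff g))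
    -- `I₀ = [a₀, b₀]`, and `I = [a, b]` in its interior
    (a₀ b₀ a b : ℝ) (ha : a₀ < a) (hab : a < b) (hb : b < b₀)
    (hAC : QMix.CondAC p (Set.Icc a₀ b₀))
    (hR : ∃ C₁' : ℝ, 2 * C₁ + 1 < C₁' ∧ QMix.FourthMoment S p (Set.Icc a₀ b₀) C₁')
    (T : Finset Γ) :
    ∃ H : ∀ n, Submodule ℂ (EuclideanSpace ℂ (Fin (N n))),
      Tendsto (fun n => (Module.finrank ℂ (H n) : ℝ) / (N n : ℝ)) atTop (𝓝 0) ∧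
      ∀ (φ : ∀ n, OrthonormalBasis (Fin (N n)) ℂ (EuclideanSpace ℂ (Fin (N n))))
        (ev : ∀ n, Fin (N n) → ℝ),
        (∀ n, QMix.IsEigenbasis (QMix.permAlg (ρ n) p) (φ n) (ev n)) →
      ∀ K : ∀ n, Matrix (Fin (N n)) (Fin (N n)) ℂ,
        (∀ n, QMix.IsLocal (ρ n) T (K n)) →
        (∀ n x y, ‖K n x y‖ ≤ 1) →
        (∀ n, ∀ t ∈ T, QMix.diagVec (ρ n) (K n) t ∈ (H n)ᗮ) →
        QMix.QuantumErgodic φ ev K (fun n => QMix.average (ρ n) T (K n)) (Set.Icc a b) ∧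
        QMix.QuantumMixing φ ev K (fun n => QMix.average (ρ n) T (K n)) (Set.Icc a b) := by
  obtain ⟨C₁', hC₁', hFM⟩ := hR
  -- A single `M` for all energies in `I₀`, all scales up to 1 and all possible spectral values.
  have hM : ∀ E ∈ Set.Icc a₀ b₀, ∀ η : ℝ, 0 < η → η ≤ 1 → ∀ t : ℝ, |t| ≤ QMix.l1norm p →
      (t - E) ^ 2 + η ^ 2 ≤ (QMix.l1norm p + (|a₀| + |b₀|)) ^ 2 + 1 := by
    intro E hE η hη hη1 t ht
    have h1 : |E| ≤ |a₀| + |b₀| := by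
      rw [abs_le]
      have := neg_abs_le a₀
      have := le_abs_self b₀
      have := abs_nonneg a₀
      have := abs_nonneg b₀
      constructor <;> linarith [hE.1, hE.2]
    have h2 : (t - E) ^ 2 ≤ (QMix.l1norm p + (|a₀| + |b₀|)) ^ 2 := by
      rw [← sq_abs (t - E)]
      exact pow_le_pow_left₀ (abs_nonneg _) ((abs_sub t E).trans (add_le_add ht h1)) 2
    nlinarith
  obtain ⟨c, hc, hcard⟩ := QMix.exists_le_card_specSet hN hρ hp hAC hM
  obtain ⟨H, hH0, hH⟩ := QMix.exists_submodule_block hN hρ hRD hS hC₁' hp hAC hFM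
    (by nlinarith [sq_nonneg (QMix.l1norm p + (|a₀| + |b₀|))]) hM T
  refine ⟨H, hH0, fun φ ev hev K hK hKb hKH => ?_⟩
  have hcard' : ∀ E ∈ Set.Icc a₀ b₀, ∀ η : ℝ, 0 < η → η ≤ 1 → ∀ᶠ n in atTop,
      c * η * N n ≤ (QMix.specSet (ev n) (Set.Icc (E - η) (E + η))).card := fun E hE η h1 h2 => by
    filter_upwards [hcard E hE η h1 h2] with n hn
    exact hn (φ n) (ev n) (hev n)
  have hblock : ∀ ε : ℝ, 0 < ε → ∀ᶠ k : ℕ in atTop, ∀ i j : ℤ,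
      QMix.gridPoint k i ∈ Set.Icc a₀ b₀ → QMix.gridPoint k j ∈ Set.Icc a₀ b₀ →
      ∀ᶠ n in atTop, _ := fun ε hε => by
    filter_upwards [hH ε hε] with k hk i j hi hj
    filter_upwards [hk i j hi hj] with n hn
    exact hn (φ n) (ev n) (hev n) (K n) (hK n) (hKb n) (hKH n)
  exact ⟨QMix.quantumErgodic_of_block hN ha hab hb hc hcard' hblock,
    QMix.quantumMixing_of_block hN ha hb hc hcard' hblock⟩
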